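/- A virtual knot is an equivalence class of Gauss codes (equivalently, of oriented virtual knot diagrams in the plane) under the Reidemeister moves, change of base point and relabelling of crossings. It is *almost classical* if it has a diagram that admits an Alexander numbering, i.e. an integer-valued function $\lambda$ on the short arcs such that at every classical crossing the incoming and the outgoing arc on one side of the crossing carry the same number $\lambda$, and those on the other side both carry $\lambda+1$; explicitly, at a crossing of sign $\varepsilon$ whose incoming under-arc has number $\mu$, the outgoing over-arc has number $\mu$, while the incoming over-arc and the outgoing under-arc have number $\mu+\varepsilon$. For a diagram with $n$ classical crossings $c_1,\dots,c_n$ of signs $\varepsilon_i$, let $x_i$ be the long arc that ends at the under-crossing of $c_i$, $x_{i+1}$ the long arc that leaves it, and $x_k$ the long arc that passes over $c_i$; the *Jacobian matrix* over $\mathbb Z[t^{\pm1}]$ has as its $i$-th row the sum of the entries $t^{-\varepsilon_i}$ in column $i$, $-1$ in column $i+1$ and $1-t^{-\varepsilon_i}$ in column $k$. The *Alexander polynomial* $\Delta_K\in\mathbb Z[t^{\pm1}]$ is a generator of the smallest principal ideal containing all $(n-1)\times(n-1)$ minors of this matrix (it is $1$ for the diagram without crossings); it is defined up to units. A virtual knot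 has *period* $q>1$ if it is represented by a virtual knot diagram in the plane that misses the origin and is invariant under the rotation by $2\pi/q$ about the origin. For Laurent polynomials over a commutative ring $R$, write $f\doteq g$ if $c\,t^jf=g$ for some unit $c\in R$ and some $j\in\mathbb Z$; call $f$ trivial if $f\doteq 1$. Let $K$ be an almost classical knot and let $p$ be an odd prime such that $\Delta_K \bmod p$ is not trivial in $\mathbb F_p[t^{\pm1}]$. 1. If $\Delta_K$ is irreducible in $\mathbb Z[t^{\pm1}]$ and $\Delta_K\doteq g^2 \bmod 2$ for some irreducible $g\in\mathbb F_2[t^{\pm1}]$, then $K$ does not have period $2p$. 2. If $\Delta_K\doteq g^2$ over $\mathbb Z$ for some $g\in\mathbb Z[t^{\pm1}]$ that is irreducible over $\mathbb Z$ and whose reduction modulo $2$ is irreducible, then $K$ does not have period $2p$. -/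

import Mathlib

open scoped LaurentPolynomial ContDiff

noncomputable section

namespace VirtualKnots

/-! ### Gauss codes and virtual knots -/

/-- A letter of a Gauss code: the label of a classical crossing, whether it is being passed as an
over-crossing (`true`) or as an under-crossing (`false`), and the sign (writhe) of the crossing. -/
abbrev GaussLetter : Type := ℕ × Bool × ℤˣ

/-- The letter `O c ε`: crossing `c`, of sign `ε`, is passed along the over-strand. -/
abbrev O (c : ℕ) (ε : ℤˣ) : GaussLetter := (c, true, ε)

/-- The letter `U c ε`: crossing `c`, of sign `ε`, is passed along the under-strand. -/
abbrev U (c : ℕ) (ε : ℤˣ) : GaussLetter := (c, false, ε)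

/-- A word is a (one component) Gauss code if every label that occurs in it occurs exactly twice,
once as an over-crossing and once as an under-crossing, both times with the same sign. -/
def IsGaussCode (w : List GaussLetter) : Prop :=
  w.Nodup ∧
  (∀ (c : ℕ) (b : Bool) (ε : ℤˣ), (c, b, ε) ∈ w → (c, !b, ε) ∈ w) ∧
  (∀ (c : ℕ) (b b' : Bool) (ε ε' : ℤˣ), (c, b, ε) ∈ w → (c, b', ε') ∈ w → ε = ε')

/-- Gauss codes. A Gauss diagram is a Gauss code up to relabelling of the crossings and change of
the base point. -/
def GaussCode : Type := {w : List GaussLetter // IsGaussCode w}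

/-- The two letters `x`, `y` in the order in which they are met: `x` first if `s = 1`, and `y`
first if `s = -1`. -/
def ordered (s : ℤˣ) (x y : GaussLetter) : List GaussLetter :=
  if s = 1 then [x, y] else [y, x]

/-- Elementary changes of Gauss codes: change of base point, relabelling of the crossings, and the
oriented Reidemeister moves (all sign and orientation patterns). The virtual Reidemeister moves and
the detour move do not change the Gauss code. -/
inductive Move : List GaussLetter → List GaussLetter → Prop
  | rotate (u v : List GaussLetter) : Move (u ++ v) (v ++ u)
  | relabel (f : Equiv.Perm ℕ) (w : List GaussLetter) :
      Move w (w.map fun x => (f x.1, x.2))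
  /-- First move: a kink, passed first along the over-strand. -/
  | r1_over (c : ℕ) (ε : ℤˣ) (w : List GaussLetter) : Move w ([O c ε, U c ε] ++ w)
  /-- First move: a kink, passed first along the under-strand. -/
  | r1_under (c : ℕ) (ε : ℤˣ) (w : List GaussLetter) : Move w ([U c ε, O c ε] ++ w)
  /-- Second move, the two strands running in the same direction. -/
  | r2_direct (c d : ℕ) (ε : ℤˣ) (u v : List GaussLetter) :
      Move (u ++ v) ([O c ε, O d (-ε)] ++ u ++ [U c ε, U d (-ε)] ++ v)
  /-- Second move, the two strands running in opposite directions. -/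
  | r2_opposite (c d : ℕ) (ε : ℤˣ) (u v : List GaussLetter) :
      Move (u ++ v) ([O c ε, O d (-ε)] ++ u ++ [U d (-ε), U c ε] ++ v)
  /-- Third move. The top strand meets the middle one in `a` and the bottom one in `b`, and the
  middle strand meets the bottom one in `c`. For three oriented lines in the plane the signs of the
  crossings determine, up to the common sign `κ` which the move reverses, the order in which each
  line meets the other two. Here the strands are passed in the order top, middle, bottom. -/
  | r3_tmb (κ : ℤˣ) (a b c : ℕ) (εa εb εc : ℤˣ) (u v w : List GaussLetter) :
      Move
        (ordered (κ * (εa * εb * εc)) (O a εa) (O b εb) ++ u ++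
          ordered (κ * εa) (U a εa) (O c εc) ++ v ++ ordered (κ * εb) (U b εb) (U c εc) ++ w)
        (ordered (-κ * (εa * εb * εc)) (O a εa) (O b εb) ++ u ++
          ordered (-κ * εa) (U a εa) (O c εc) ++ v ++ ordered (-κ * εb) (U b εb) (U c εc) ++ w)
  /-- Third move, the strands being passed in the order top, bottom, middle. -/
  | r3_tbm (κ : ℤˣ) (a b c : ℕ) (εa εb εc : ℤˣ) (u v w : List GaussLetter) :
      Move
        (ordered (κ * (εa * εb * εc)) (O a εa) (O b εb) ++ u ++
          ordered (κ * εb) (U b εb) (U c εc) ++ v ++ ordered (κ * εa) (U a εa) (O c εc) ++ w)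
        (ordered (-κ * (εa * εb * εc)) (O a εa) (O b εb) ++ u ++
          ordered (-κ * εb) (U b εb) (U c εc) ++ v ++ ordered (-κ * εa) (U a εa) (O c εc) ++ w)

/-- A virtual knot is an equivalence class of Gauss codes under the equivalence relation generated
by the elementary changes. -/
def VirtualKnot : Type := Quot fun D E : GaussCode => Move D.1 E.1

/-- The virtual knot represented by a Gauss code. -/
def GaussCode.toVirtualKnot (D : GaussCode) : VirtualKnot := Quot.mk _ D

/-! ### Almost classical knots -/

/-- An Alexander numbering of a Gauss code: `lam k` is the number of the short arc which enters the
`k`-th letter (so `lam (k + 1)` is the number of the short arc which leaves it). At each crossing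
the two arcs on one side of the crossing carry the same number, and the numbers on the two sides
differ by one: with `lam j` the number of the incoming under-arc of a crossing of sign `ε`, the
incoming over-arc and the outgoing under-arc have number `lam j + ε`, and the outgoing over-arc has
number `lam j`. -/
def IsAlexanderNumbering (w : List GaussLetter) (lam : ℕ → ℤ) : Prop :=
  lam w.length = lam 0 ∧
  ∀ (c : ℕ) (ε : ℤˣ) (i j : ℕ), w[i]? = some (O c ε) → w[j]? = some (U c ε) →
    lam i = lam j + (ε : ℤ) ∧ lam (j + 1) = lam j + (ε : ℤ) ∧ lam (i + 1) = lam j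

/-- A virtual knot is almost classical if it has an Alexander numberable diagram. -/
def VirtualKnot.IsAlmostClassical (K : VirtualKnot) : Prop :=
  ∃ D : GaussCode, D.toVirtualKnot = K ∧ ∃ lam : ℕ → ℤ, IsAlexanderNumbering D.1 lam

/-! ### The Alexander polynomial -/

/-- The labels of the crossings of a Gauss code. -/
def crossings (w : List GaussLetter) : Finset ℕ := (w.map fun x => x.1).toFinset

/-- The sign of the crossing with label `c`. -/
def crossingSign (w : List GaussLetter) (c : ℕ) : ℤˣ := if O c 1 ∈ w then 1 else -1

/-- The label of the first under-crossing that is met when the code is read cyclically, starting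
with the `k`-th letter. A long arc runs from one under-crossing to the next and is named after the
crossing at which it ends. -/
def nextUnder (w : List GaussLetter) (k : ℕ) : ℕ :=
  (((w.rotate k).find? fun x => !x.2.1).map fun x => x.1).getD 0

/-- The long arc that leaves the under-crossing of `c`. -/
def outgoingArc (w : List GaussLetter) (c : ℕ) : ℕ :=
  nextUnder w (w.idxOf (U c (crossingSign w c)) + 1)

/-- The long arc that passes over the crossing `c`. -/
def overArc (w : List GaussLetter) (c : ℕ) : ℕ :=
  nextUnder w (w.idxOf (O c (crossingSign w c)))

/-- The Jacobian matrix of the Wirtinger presentation of the knot group: the Fox derivatives of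
the relators `x_k^{-ε} x_i x_k^ε x_{i+1}^{-1}`, with every generator sent to `t`. Here `x_i` is the
long arc which ends at the crossing `i`, `x_{i+1}` the one which leaves it, `x_k` the one which
passes over it. The rows are indexed by the crossings, the columns by the long arcs. -/
def jacobian (w : List GaussLetter) : Matrix (crossings w) (crossings w) ℤ[T;T⁻¹] :=
  Matrix.of fun i j =>
    (if j.1 = i.1 then LaurentPolynomial.T (-(crossingSign w i.1 : ℤ)) else 0)
    - (if j.1 = outgoingArc w i.1 then 1 else 0)
    + (if j.1 = overArc w i.1 then 1 - LaurentPolynomial.T (-(crossingSign w i.1 : ℤ)) else 0)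

/-- The first elementary ideal: it is generated by the `(n - 1) × (n - 1)` minors of the `n × n`
Jacobian matrix (minors with a repeated row or column are zero). For a code without crossings the
empty minor gives the unit ideal, as it should for the trivial knot. -/
def firstElementaryIdeal (w : List GaussLetter) : Ideal ℤ[T;T⁻¹] :=
  Ideal.span {d | ∃ r c : Fin ((crossings w).card - 1) → crossings w,
    d = ((jacobian w).submatrix r c).det}

/-- `Δ` is an Alexander polynomial of `K`: a generator of the smallest principal ideal that
contains the first elementary ideal of a diagram of `K`. -/
def VirtualKnot.IsAlexanderPolynomial (K : VirtualKnot) (Δ : ℤ[T;T⁻¹]) : Prop :=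
  ∃ D : GaussCode, D.toVirtualKnot = K ∧
    firstElementaryIdeal D.1 ≤ Ideal.span {Δ} ∧
    ∀ d : ℤ[T;T⁻¹], firstElementaryIdeal D.1 ≤ Ideal.span {d} →
      Ideal.span {Δ} ≤ Ideal.span {d}

/-- `f ≐ g`: equality up to multiplication by `c t ^ j` with `c` a unit of the coefficient ring. -/
def DotEq {R : Type*} [CommRing R] (f g : R[T;T⁻¹]) : Prop :=
  ∃ (c : Rˣ) (j : ℤ), LaurentPolynomial.C (c : R) * LaurentPolynomial.T j * f = g

/-- Reduction of the coefficients modulo `m`. -/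
def reduceMod (m : ℕ) : ℤ[T;T⁻¹] →+* (ZMod m)[T;T⁻¹] :=
  AddMonoidAlgebra.mapRingHom ℤ (Int.castRingHom (ZMod m))

/-! ### Virtual knot diagrams in the plane and periodicity -/

/-- The cross product of two vectors of the plane. -/
def cross (z w : ℂ) : ℝ := ((starRingEnd ℂ) z * w).im

/-- Two real parameters that give the same point of the circle `ℝ / ℤ`. -/
def SamePoint (s t : ℝ) : Prop := ∃ m : ℤ, t = s + m

/-- An oriented virtual knot diagram: a smooth immersion of the circle `ℝ / ℤ` in the plane whose
only multiple points are transverse double points, some of which are marked as classical.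
`isOver s t` says that the parameters `s` and `t` form a classical crossing and that the branch at
`s` is the upper one; all other double points are virtual. -/
structure VirtualKnotDiagram where
  curve : ℝ → ℂ
  smooth : ContDiff ℝ ∞ curve
  periodic : ∀ s, curve (s + 1) = curve s
  immersion : ∀ s, deriv curve s ≠ 0
  no_triple : ∀ r s t, curve r = curve s → curve s = curve t →
    SamePoint r s ∨ SamePoint s t ∨ SamePoint r t
  transverse : ∀ s t, curve s = curve t → ¬ SamePoint s t →
    cross (deriv curve s) (deriv curve t) ≠ 0
  isOver : ℝ → ℝ → Prop
  over_double : ∀ s t, isOver s t → curve s = curve t ∧ ¬ SamePoint s t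
  over_asymm : ∀ s t, isOver s t → ¬ isOver t s
  over_periodic : ∀ (s t : ℝ) (m n : ℤ), isOver s t → isOver (s + m) (t + n)

/-- `w` is a Gauss code of the diagram `P`: its letters are the passages of the classical crossings
in the order in which they are met when the knot is traversed once from the base point `0`. A
crossing is positive if the direction of the over-strand, followed by that of the under-strand, is
a positively oriented frame of the plane. -/
def VirtualKnotDiagram.HasGaussCode (P : VirtualKnotDiagram) (w : List GaussLetter) : Prop :=
  ∃ s : Fin w.length → ℝ, StrictMono s ∧ (∀ i, s i ∈ Set.Ico (0 : ℝ) 1) ∧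
    (∀ (i j : Fin w.length) (c : ℕ) (ε : ℤˣ), w.get i = O c ε → w.get j = U c ε →
      P.isOver (s i) (s j) ∧
      0 < ((ε : ℤ) : ℝ) * cross (deriv P.curve (s i)) (deriv P.curve (s j))) ∧
    (∀ a ∈ Set.Ico (0 : ℝ) 1, ∀ b ∈ Set.Ico (0 : ℝ) 1, P.isOver a b →
      ∃ (i j : Fin w.length) (c : ℕ) (ε : ℤˣ),
        s i = a ∧ s j = b ∧ w.get i = O c ε ∧ w.get j = U c ε)

/-- The diagram is periodic with period `q > 1`: it misses the origin and is invariant under the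
rotation about the origin by the angle `2π / q`, that is, the rotated diagram is a
reparametrization (by a diffeomorphism `h` of the circle) of the diagram, with the same classical
crossings and the same over- and under-strands. -/
def VirtualKnotDiagram.IsPeriodic (P : VirtualKnotDiagram) (q : ℕ) : Prop :=
  1 < q ∧ (∀ s, P.curve s ≠ 0) ∧
  ∃ h : ℝ → ℝ, ContDiff ℝ ∞ h ∧ (∀ s, 0 < deriv h s) ∧ (∀ s, h (s + 1) = h s + 1) ∧
    (∀ s, P.curve (h s) = Complex.exp (2 * Real.pi * Complex.I / q) * P.curve s) ∧
    (∀ s t, P.isOver (h s) (h t) ↔ P.isOver s t)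

/-- A virtual knot has period `q` if it is represented by a diagram that is periodic with period
`q`. -/
def VirtualKnot.HasPeriod (K : VirtualKnot) (q : ℕ) : Prop :=
  ∃ P : VirtualKnotDiagram, P.IsPeriodic q ∧
    ∃ D : GaussCode, P.HasGaussCode D.1 ∧ D.toVirtualKnot = K

end VirtualKnots

end

/-! Write Λ = ℤ[t^{±1}]. A rotation of order 2p acts freely on the classical crossings of the
diagram, because the diagram misses the origin. Indexing crossings by orbit and position in the
orbit therefore makes the Jacobian block circulant. Its symbol A(X), a matrix over Λ[X], has rows
that sum to zero at X = 1, so det A(X) = (1 - X) B(X). Diagonalising over the 2p-th roots of unity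
gives (`adjugate_blockCirculant_eq`) that the adjugate entries of the Jacobian are those of A(1)
times N_2 N_p N_{2p}, where N_d is the product of the values of B at the primitive d-th roots of
unity. Since Δ is a greatest common divisor of these entries, Δ = k N_2 N_p N_{2p} with B(1) = k f
(`exists_factorization_of_blockCirculant`). Put D_2 = k N_2 and D_p = k N_p, both divisors of Δ.
Modulo 2 one has -1 = 1 and Φ_{2p} = Φ_p; modulo p one has Φ_p = (X - 1)^{p-1} and Φ_{2p} = (X +
1)^{p-1}. Hence there are congruences of Murasugi type: Δ ≡ D_p² f and D_2 ≡ k² f modulo 2, and Δ ≡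
D_2^p f^{p-1} and D_p ≡ k^p f^{p-1} modulo p. If Δ is irreducible or the square of an irreducible,
D_2 and D_p have very few possible values, and each contradicts a congruence
(`Irreducible.not_of_congruences`, `not_associated_sq_of_congruences`). Two facts connect this
algebra with knots. The ideal of minors may be computed from any diagram of K: a Gauss code has a
universal colouring module, invariant under the moves (`Move.colourModule`) and presented by the
Jacobian (`exists_isPresentation_jacobian`), and square presentations of one module have the same
adjugate ideal (`IsPresentation.adjIdeal_eq`). And a rotation of the diagram is a cyclic symmetry of
its Gauss code (`IsPeriodic.exists_isCodeSymmetry`), since on the universal cover of the circle it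
shifts the list of crossing passages. -/

namespace VirtualKnots

/-! ### The adjugate ideal of a square presentation matrix depends only on the module. -/

section AdjugateIdeal

variable {R : Type*} [CommRing R]
variable {ι κ : Type*} [Fintype ι] [DecidableEq ι] [Fintype κ] [DecidableEq κ]

/-- The ideal generated by the entries of the adjugate of a square matrix. -/
def adjIdeal (S : Matrix ι ι R) : Ideal R :=
  Ideal.span (Set.range fun x : ι × ι => S.adjugate x.1 x.2)

theorem adjugate_mem_adjIdeal (S : Matrix ι ι R) (i j : ι) : S.adjugate i j ∈ adjIdeal S :=
  Ideal.subset_span ⟨(i, j), rfl⟩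

theorem adjIdeal_le_iff {S : Matrix ι ι R} {I : Ideal R} :
    adjIdeal S ≤ I ↔ ∀ i j, S.adjugate i j ∈ I := by
  rw [adjIdeal, Ideal.span_le]
  constructor
  · intro h i j
    exact h ⟨(i, j), rfl⟩
  · rintro h _ ⟨x, rfl⟩
    exact h x.1 x.2

theorem adjIdeal_mul_le_left (A B : Matrix ι ι R) : adjIdeal (A * B) ≤ adjIdeal A := by
  rw [adjIdeal_le_iff]
  intro i j
  rw [Matrix.adjugate_mul_distrib, Matrix.mul_apply]
  exact Ideal.sum_mem _ fun k _ => Ideal.mul_mem_left _ _ (adjugate_mem_adjIdeal A k j)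

theorem adjIdeal_mul_le_right (A B : Matrix ι ι R) : adjIdeal (A * B) ≤ adjIdeal B := by
  rw [adjIdeal_le_iff]
  intro i j
  rw [Matrix.adjugate_mul_distrib, Matrix.mul_apply]
  exact Ideal.sum_mem _ fun k _ => Ideal.mul_mem_right _ _ (adjugate_mem_adjIdeal B i k)

theorem det_mem_adjIdeal [Nonempty ι] (S : Matrix ι ι R) : S.det ∈ adjIdeal S := by
  obtain ⟨i⟩ := ‹Nonempty ι›
  have h : (S * S.adjugate) i i = S.det := by
    rw [Matrix.mul_adjugate]; simp
  rw [← h, Matrix.mul_apply]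
  exact Ideal.sum_mem _ fun k _ => Ideal.mul_mem_left _ _ (adjugate_mem_adjIdeal S k i)

theorem adjIdeal_reindex (e : ι ≃ κ) (S : Matrix ι ι R) :
    adjIdeal (Matrix.reindex e e S) = adjIdeal S := by
  apply le_antisymm
  · rw [adjIdeal_le_iff]
    intro i j
    rw [Matrix.adjugate_reindex]
    exact adjugate_mem_adjIdeal S _ _
  · rw [adjIdeal_le_iff]
    intro i j
    have := adjugate_mem_adjIdeal (Matrix.reindex e e S) (e i) (e j)
    rw [Matrix.adjugate_reindex] at this
    simpa using this

/-- Redundant generators do not matter. Unipotent column operations remove `C`; in the block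
diagonal case a cofactor is an entry of the adjugate of `S`, zero, or a multiple of `S.det`. The
last belongs to the ideal only because `ι` is nonempty. -/
theorem adjIdeal_fromBlocks_one_eq [Nonempty ι] (S : Matrix ι ι R) (C : Matrix κ ι R) :
    adjIdeal (Matrix.fromBlocks S 0 C (1 : Matrix κ κ R)) = adjIdeal S := by
  have key : adjIdeal (Matrix.fromBlocks S 0 0 (1 : Matrix κ κ R)) = adjIdeal S := by
    apply le_antisymm
    · rw [adjIdeal_le_iff]
      rintro (i | i) (j | j)
      · have : (Matrix.fromBlocks S 0 0 (1 : Matrix κ κ R)).updateRow (Sum.inl j)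
            (Pi.single (Sum.inl i) 1)
            = Matrix.fromBlocks (S.updateRow j (Pi.single i 1)) 0 0 (1 : Matrix κ κ R) := by
          ext (a | a) (b | b) <;> simp [Matrix.updateRow_apply, Pi.single_apply]
        rw [Matrix.adjugate_apply, this, Matrix.det_fromBlocks_zero₂₁, Matrix.det_one, mul_one,
          ← Matrix.adjugate_apply]
        exact adjugate_mem_adjIdeal S i j
      · have : (Matrix.fromBlocks S 0 0 (1 : Matrix κ κ R)).updateRow (Sum.inr j)
            (Pi.single (Sum.inl i) 1)
            = Matrix.fromBlocks S 0 (Matrix.of fun a b => if a = j then if b = i then 1 else 0 else 0)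
              ((1 : Matrix κ κ R).updateRow j 0) := by
          ext (a | a) (b | b) <;> simp [Matrix.updateRow_apply, Pi.single_apply]
        rw [Matrix.adjugate_apply, this, Matrix.det_fromBlocks_zero₁₂]
        exact Ideal.mul_mem_right _ _ (det_mem_adjIdeal S)
      · have : (Matrix.fromBlocks S 0 0 (1 : Matrix κ κ R)).updateRow (Sum.inl j)
            (Pi.single (Sum.inr i) 1)
            = Matrix.fromBlocks (S.updateRow j 0)
              (Matrix.of fun a b => if a = j then if b = i then 1 else 0 else 0) 0 (1 : Matrix κ κ R) := by
          ext (a | a) (b | b) <;> simp [Matrix.updateRow_apply, Pi.single_apply]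
        rw [Matrix.adjugate_apply, this, Matrix.det_fromBlocks_zero₂₁,
          Matrix.det_eq_zero_of_row_eq_zero j (by simp), zero_mul]
        exact zero_mem _
      · have : (Matrix.fromBlocks S 0 0 (1 : Matrix κ κ R)).updateRow (Sum.inr j)
            (Pi.single (Sum.inr i) 1)
            = Matrix.fromBlocks S 0 0 ((1 : Matrix κ κ R).updateRow j (Pi.single i 1)) := by
          ext (a | a) (b | b) <;> simp [Matrix.updateRow_apply, Pi.single_apply]
        rw [Matrix.adjugate_apply, this, Matrix.det_fromBlocks_zero₁₂]
        exact Ideal.mul_mem_right _ _ (det_mem_adjIdeal S)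
    · rw [adjIdeal_le_iff]
      intro i j
      have : (Matrix.fromBlocks S 0 0 (1 : Matrix κ κ R)).updateRow (Sum.inl j)
            (Pi.single (Sum.inl i) 1)
            = Matrix.fromBlocks (S.updateRow j (Pi.single i 1)) 0 0 (1 : Matrix κ κ R) := by
        ext (a | a) (b | b) <;> simp [Matrix.updateRow_apply, Pi.single_apply]
      have h := adjugate_mem_adjIdeal (Matrix.fromBlocks S 0 0 (1 : Matrix κ κ R))
        (Sum.inl i) (Sum.inl j)
      rwa [Matrix.adjugate_apply, this, Matrix.det_fromBlocks_zero₂₁, Matrix.det_one, mul_one,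
        ← Matrix.adjugate_apply] at h
  rw [← key]
  apply le_antisymm
  · have : Matrix.fromBlocks S 0 C (1 : Matrix κ κ R)
        = Matrix.fromBlocks S 0 0 1 * Matrix.fromBlocks 1 0 C 1 := by
      simp [Matrix.fromBlocks_multiply]
    rw [this]
    exact adjIdeal_mul_le_left _ _
  · have : Matrix.fromBlocks S 0 0 (1 : Matrix κ κ R)
        = Matrix.fromBlocks S 0 C 1 * Matrix.fromBlocks 1 0 (-C) 1 := by
      simp [Matrix.fromBlocks_multiply]
    rw [this]
    exact adjIdeal_mul_le_left _ _

/-- Rows are relations, `Φ` and `Ψ` translate between the two sets of generators. After both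
matrices are enlarged to the common index type `ι ⊕ κ`, the hypotheses say exactly that the enlarged
`S` is a left multiple of the enlarged `J`, and adjugates are multiplicative. -/
theorem adjIdeal_le_of_mul_eq [Nonempty ι] [Nonempty κ] {S : Matrix ι ι R} {J : Matrix κ κ R}
    {Φ : Matrix ι κ R} {Ψ : Matrix κ ι R} {C : Matrix ι κ R} {D : Matrix κ κ R}
    (h₁ : S * Φ = C * J) (h₂ : 1 - Ψ * Φ = D * J) : adjIdeal S ≤ adjIdeal J := by
  rw [← adjIdeal_fromBlocks_one_eq S (-Ψ), ← adjIdeal_fromBlocks_one_eq J (-Φ),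
    ← adjIdeal_reindex (Equiv.sumComm κ ι)]
  have e : Matrix.reindex (Equiv.sumComm κ ι) (Equiv.sumComm κ ι)
      (Matrix.fromBlocks J 0 (-Φ) 1) = Matrix.fromBlocks 1 (-Φ) 0 J := by
    simp [Matrix.reindex_apply]
  have h : Matrix.fromBlocks S 0 (-Ψ) 1
      = Matrix.fromBlocks S C (-Ψ) D * Matrix.fromBlocks 1 (-Φ) 0 J := by
    simp [Matrix.fromBlocks_multiply, ← h₁, ← h₂]
  rw [e, h]
  exact adjIdeal_mul_le_right _ _

/-- The matrix `J` presents the module `N` on the generators `π (Pi.single i 1)`. -/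
structure IsPresentation {N : Type*} [AddCommGroup N] [Module R N] (J : Matrix κ κ R)
    (π : (κ → R) →ₗ[R] N) : Prop where
  surjective : Function.Surjective π
  ker_eq : LinearMap.ker π = Submodule.span R (Set.range fun i => J i)

omit [Fintype ι] [DecidableEq ι] [DecidableEq κ] in
theorem exists_mul_eq_of_rows_mem {J : Matrix κ κ R} {A : Matrix ι κ R}
    (h : ∀ i, A i ∈ Submodule.span R (Set.range fun k => J k)) :
    ∃ C : Matrix ι κ R, A = C * J := by
  have h' : ∀ i, ∃ c : κ → R, ∑ k, c k • J k = A i := fun i =>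
    (Submodule.mem_span_range_iff_exists_fun R).1 (h i)
  choose c hc using h'
  refine ⟨Matrix.of c, ?_⟩
  ext i j
  rw [← hc i, Matrix.mul_apply]
  simp

/-- Expressing each set of generators through the other gives `Φ` and `Ψ`. The two required
identities hold in `N`, hence modulo the rows of `J`, which span the kernel. -/
theorem IsPresentation.adjIdeal_le [Nonempty ι] [Nonempty κ] {N : Type*} [AddCommGroup N]
    [Module R N] {S : Matrix ι ι R} {J : Matrix κ κ R} {π : (ι → R) →ₗ[R] N}
    {ρ : (κ → R) →ₗ[R] N} (hS : IsPresentation S π) (hJ : IsPresentation J ρ) :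
    adjIdeal S ≤ adjIdeal J := by
  choose Φ hΦ using fun i => hJ.surjective (π (Pi.single i 1))
  choose Ψ hΨ using fun k => hS.surjective (ρ (Pi.single k 1))
  have vm : ∀ a : ι → R, ρ (Matrix.vecMul a (Matrix.of Φ)) = π a := by
    intro a
    rw [Matrix.vecMul_eq_sum, map_sum]
    conv_rhs => rw [pi_eq_sum_univ' a, map_sum]
    refine Finset.sum_congr rfl fun i _ => ?_
    rw [map_smul, map_smul]
    congr 1
    exact hΦ i
  obtain ⟨C, hC⟩ := exists_mul_eq_of_rows_mem (J := J) (A := S * Matrix.of Φ) (by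
    intro i
    rw [← hJ.ker_eq, LinearMap.mem_ker]
    refine (vm (S i)).trans ?_
    rw [← LinearMap.mem_ker, hS.ker_eq]
    exact Submodule.subset_span ⟨i, rfl⟩)
  obtain ⟨D, hD⟩ := exists_mul_eq_of_rows_mem (J := J)
    (A := 1 - Matrix.of Ψ * Matrix.of Φ) (by
    intro k
    rw [← hJ.ker_eq, LinearMap.mem_ker]
    have : (1 - Matrix.of Ψ * Matrix.of Φ : Matrix κ κ R) k
        = Pi.single k 1 - Matrix.vecMul (Ψ k) (Matrix.of Φ) := by
      ext l
      simp [Matrix.one_apply, Pi.single_apply, Matrix.mul_apply, Matrix.vecMul, dotProduct, eq_comm]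
    rw [this, map_sub, vm, hΨ, sub_self])
  exact adjIdeal_le_of_mul_eq hC hD

theorem IsPresentation.adjIdeal_eq [Nonempty ι] [Nonempty κ] {N : Type*} [AddCommGroup N]
    [Module R N] {S : Matrix ι ι R} {J : Matrix κ κ R} {π : (ι → R) →ₗ[R] N}
    {ρ : (κ → R) →ₗ[R] N} (hS : IsPresentation S π) (hJ : IsPresentation J ρ) :
    adjIdeal S = adjIdeal J :=
  le_antisymm (hS.adjIdeal_le hJ) (hJ.adjIdeal_le hS)

omit [Fintype κ] [DecidableEq κ] in
theorem IsPresentation.comp_equiv {N N' : Type*} [AddCommGroup N] [Module R N]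
    [AddCommGroup N'] [Module R N'] {J : Matrix κ κ R} {ρ : (κ → R) →ₗ[R] N}
    (hJ : IsPresentation J ρ) (e : N ≃ₗ[R] N') : IsPresentation J (e.toLinearMap ∘ₗ ρ) := by
  refine ⟨e.surjective.comp hJ.surjective, ?_⟩
  rw [LinearMap.ker_comp, LinearEquiv.ker, ← hJ.ker_eq]
  rfl

/-- Maximal proper minors, with rows and columns chosen in any order, generate the same ideal as the
entries of the adjugate. -/
theorem span_minors_eq_adjIdeal {n : ℕ} (hn : Fintype.card κ = n + 1) (J : Matrix κ κ R) :
    Ideal.span {d | ∃ r c : Fin n → κ, d = (J.submatrix r c).det} = adjIdeal J := by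
  let e : κ ≃ Fin (n + 1) := Fintype.equivFinOfCardEq hn
  rw [← adjIdeal_reindex e]
  set A := Matrix.reindex e e J with hA
  apply le_antisymm
  · rw [Ideal.span_le]
    rintro _ ⟨r, c, rfl⟩
    have hJA : J.submatrix r c = A.submatrix (e ∘ r) (e ∘ c) := by
      ext i j; simp [hA]
    rw [hJA]
    -- An injective choice of `n` among `n + 1` indices omits one of them, so it is `succAbove` up
    -- to a permutation, which changes the minor only by a sign.
    have miss : ∀ s : Fin n → Fin (n + 1), Function.Injective s →
        ∃ (i : Fin (n + 1)) (σ : Equiv.Perm (Fin n)), s = i.succAbove ∘ σ := by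
      intro s hs
      obtain ⟨i, hi⟩ : ∃ i, ∀ k, s k ≠ i := by
        by_contra! h
        have := Fintype.card_le_of_surjective s h
        simp at this
      choose σ hσ using fun k => Fin.exists_succAbove_eq (hi k)
      have hσi : Function.Injective σ := fun a b hab => hs (by rw [← hσ a, ← hσ b, hab])
      exact ⟨i, Equiv.ofBijective σ hσi.bijective_of_finite, funext fun k => (hσ k).symm⟩
    by_cases hr : Function.Injective (e ∘ r)
    · by_cases hc : Function.Injective (e ∘ c)
      · obtain ⟨i, σ, h₁⟩ := miss _ hr
        obtain ⟨j, τ, h₂⟩ := miss _ hc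
        rw [h₁, h₂]
        have : A.submatrix (i.succAbove ∘ σ) (j.succAbove ∘ τ)
            = ((A.submatrix i.succAbove j.succAbove).submatrix σ id).submatrix id τ := rfl
        rw [this, Matrix.det_permute', Matrix.det_permute]
        refine Ideal.mul_mem_left _ _ (Ideal.mul_mem_left _ _ ?_)
        have h := adjugate_mem_adjIdeal A j i
        rw [Matrix.adjugate_fin_succ_eq_det_submatrix] at h
        have h' := Ideal.mul_mem_left _ ((-1) ^ (i + j : ℕ)) h
        rwa [← mul_assoc, ← pow_add, Even.neg_one_pow ⟨_, rfl⟩, one_mul] at h'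
      · simp only [Function.Injective, not_forall] at hc
        obtain ⟨a, b, hab, hne⟩ := hc
        rw [Matrix.det_zero_of_column_eq hne (by intro k; simp only [Matrix.submatrix_apply, hab])]
        exact zero_mem _
    · simp only [Function.Injective, not_forall] at hr
      obtain ⟨a, b, hab, hne⟩ := hr
      rw [Matrix.det_zero_of_row_eq hne (by ext k; simp only [Matrix.submatrix_apply, hab])]
      exact zero_mem _
  · rw [adjIdeal_le_iff]
    intro i j
    rw [Matrix.adjugate_fin_succ_eq_det_submatrix]
    refine Ideal.mul_mem_left _ _ (Ideal.subset_span
      ⟨e.symm ∘ j.succAbove, e.symm ∘ i.succAbove, ?_⟩)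
    rfl

end AdjugateIdeal
end VirtualKnots

namespace VirtualKnots
-- Units, factorization and reduction of Laurent polynomials.
section LaurentPolynomials

instance laurentPolynomial_uniqueFactorizationMonoid {R : Type*} [CommRing R] [IsDomain R]
    [UniqueFactorizationMonoid R] : UniqueFactorizationMonoid R[T;T⁻¹] :=
  UniqueFactorizationMonoid.of_isLocalization (Submonoid.powers (Polynomial.X : Polynomial R)) _

/-- Clearing denominators in `f * g = 1` shows that an ordinary polynomial divides a power of the
prime `X`, so it is a unit times a power of `X`. -/
theorem laurentPolynomial_isUnit_iff {R : Type*} [CommRing R] [IsDomain R] {f : R[T;T⁻¹]} :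
    IsUnit f ↔ ∃ (c : Rˣ) (j : ℤ), f = LaurentPolynomial.C (c : R) * LaurentPolynomial.T j := by
  constructor
  · intro hf
    obtain ⟨g, hg⟩ := hf.exists_right_inv
    obtain ⟨m, f', hf'⟩ := LaurentPolynomial.exists_T_pow f
    obtain ⟨n, g', hg'⟩ := LaurentPolynomial.exists_T_pow g
    have h : f' * g' = Polynomial.X ^ (m + n) := by
      apply Polynomial.toLaurent_injective
      rw [map_mul, hf', hg', Polynomial.toLaurent_X_pow]
      push_cast
      rw [LaurentPolynomial.T_add]
      linear_combination (LaurentPolynomial.T (m : ℤ) * LaurentPolynomial.T (n : ℤ)) * hg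
    have hd : f' ∣ Polynomial.X ^ (m + n) := ⟨g', h.symm⟩
    rw [dvd_prime_pow Polynomial.prime_X] at hd
    obtain ⟨i, -, u, hu⟩ := hd
    obtain ⟨c, hc, hcu⟩ := Polynomial.isUnit_iff.1 (u⁻¹).isUnit
    have hf'' : f' = Polynomial.X ^ i * Polynomial.C c := by
      rw [hcu, ← hu, mul_assoc, Units.mul_inv, mul_one]
    refine ⟨hc.unit, (i : ℤ) - m, ?_⟩
    have : f = f * LaurentPolynomial.T m * LaurentPolynomial.T (-m) := by
      rw [mul_assoc, ← LaurentPolynomial.T_add]; simp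
    rw [this, ← hf', hf'', map_mul, Polynomial.toLaurent_X_pow, Polynomial.toLaurent_C, mul_comm,
      mul_comm (LaurentPolynomial.T (i : ℤ)), mul_left_comm, ← LaurentPolynomial.T_add]
    simp [sub_eq_neg_add]
  · rintro ⟨c, j, rfl⟩
    exact (c.isUnit.map _).mul (LaurentPolynomial.isUnit_T j)

theorem dotEq_iff_associated {R : Type*} [CommRing R] [IsDomain R] {f g : R[T;T⁻¹]} :
    DotEq f g ↔ Associated f g := by
  constructor
  · rintro ⟨c, j, rfl⟩
    have h : IsUnit (LaurentPolynomial.C (c : R) * LaurentPolynomial.T j) :=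
      laurentPolynomial_isUnit_iff.2 ⟨c, j, rfl⟩
    exact ⟨h.unit, by rw [IsUnit.unit_spec, mul_comm]⟩
  · rintro ⟨u, rfl⟩
    obtain ⟨c, j, h⟩ := laurentPolynomial_isUnit_iff.1 u.isUnit
    exact ⟨c, j, by rw [h, mul_comm]⟩

theorem reduceMod_toLaurent (m : ℕ) (f : Polynomial ℤ) :
    reduceMod m (Polynomial.toLaurent f)
      = Polynomial.toLaurent (f.map (Int.castRingHom (ZMod m))) := by
  induction f using Polynomial.induction_on' with
  | add a b ha hb => simp only [map_add, Polynomial.map_add, ha, hb]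
  | monomial n a =>
    rw [Polynomial.map_monomial, Polynomial.toLaurent_C_mul_T, Polynomial.toLaurent_C_mul_T,
      ← LaurentPolynomial.single_eq_C_mul_T, ← LaurentPolynomial.single_eq_C_mul_T, reduceMod,
      AddMonoidAlgebra.mapRingHom_single]

theorem C_dvd_of_reduceMod_eq_zero {m : ℕ} {f : ℤ[T;T⁻¹]} (h : reduceMod m f = 0) :
    LaurentPolynomial.C (m : ℤ) ∣ f := by
  obtain ⟨n, f', hf'⟩ := LaurentPolynomial.exists_T_pow f
  have h₁ : f'.map (Int.castRingHom (ZMod m)) = 0 := by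
    apply Polynomial.toLaurent_injective
    rw [← reduceMod_toLaurent, hf', map_mul, h, zero_mul, map_zero]
  have h₂ : Polynomial.C (m : ℤ) ∣ f' := by
    rw [Polynomial.C_dvd_iff_dvd_coeff]
    intro i
    have := congrArg (fun q => Polynomial.coeff q i) h₁
    simpa [Polynomial.coeff_map, ZMod.intCast_zmod_eq_zero_iff_dvd] using this
  have h₃ := map_dvd Polynomial.toLaurent h₂
  rw [Polynomial.toLaurent_C, hf'] at h₃
  exact ((LaurentPolynomial.isUnit_T _).dvd_mul_right).1 h₃

end LaurentPolynomials

/-! ### The conclusion from the congruences -/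
section Congruences

variable {A F G : Type*} [CommRing A] [IsDomain A] [UniqueFactorizationMonoid A]
  [CommRing F] [IsDomain F] [CommRing G] [IsDomain G]

omit [UniqueFactorizationMonoid A] [IsDomain A] in
-- The square of `ψ Δ` divides `ψ D ^ p * z = ψ Δ`, and one factor cancels.
theorem isUnit_map_of_eq_pow_mul (ψ : A →+* G) {p : ℕ} (hp : 2 ≤ p) {Δ D : A} {z : G}
    (hD : Associated D Δ) (h : ψ Δ = ψ D ^ p * z) (hne : ψ Δ ≠ 0) : IsUnit (ψ Δ) := by
  obtain ⟨q, rfl⟩ := Nat.exists_eq_add_of_le hp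
  have hd : ψ Δ * ψ Δ ∣ ψ Δ * 1 := by
    have h₁ : ψ Δ ∣ ψ D := map_dvd ψ hD.symm.dvd
    rw [mul_one]
    conv_rhs => rw [h, pow_add, mul_assoc, pow_two]
    exact Dvd.dvd.mul_right (mul_dvd_mul h₁ h₁) _
  exact isUnit_of_dvd_one ((mul_dvd_mul_iff_left hne).1 hd)

omit [UniqueFactorizationMonoid A] [IsDomain A] in
-- If `Dp` is associated to `Δ`, then `h₁` makes `φ Δ` a unit; if `D₂` is, then `h₃` makes `ψ Δ` a
-- unit. If both are units, `h₂` makes `φ f` a unit and `h₁` then does so for `φ Δ`.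
theorem Irreducible.not_of_congruences (φ : A →+* F) (ψ : A →+* G) {p : ℕ} (hp : 2 ≤ p)
    {Δ k D₂ Dp f : A} (h2 : D₂ ∣ Δ) (hp' : Dp ∣ Δ)
    (h₁ : φ Δ = φ Dp ^ 2 * φ f) (h₂ : φ D₂ = φ k ^ 2 * φ f)
    (h₃ : ψ Δ = ψ D₂ ^ p * ψ f ^ (p - 1))
    (hne : ψ Δ ≠ 0) (hnu : ¬ IsUnit (ψ Δ)) (hne' : φ Δ ≠ 0) (hnu' : ¬ IsUnit (φ Δ)) :
    ¬ Irreducible Δ := by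
  intro hΔ
  rcases hΔ.dvd_iff.1 hp' with hu | ha
  · rcases hΔ.dvd_iff.1 h2 with hu2 | ha2
    · have hf : IsUnit (φ f) := isUnit_of_dvd_unit (h₂ ▸ dvd_mul_left _ _) (hu2.map φ)
      exact hnu' (h₁ ▸ ((hu.map φ).pow 2).mul hf)
    · exact hnu (isUnit_map_of_eq_pow_mul ψ hp ha2.symm h₃ hne)
  · exact hnu' (isUnit_map_of_eq_pow_mul φ le_rfl ha.symm h₁ hne')

/-- Both `D₂` and `Dp` are associated to 1, `g` or `g ^ 2`. The full square is excluded as in the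
irreducible case. If `D₂` were `g`, the cube of `ψ g` would divide its square, which is where `3 ≤
p` enters. So `D₂` is a unit, and `Dp` is a unit or `g`. -/
theorem not_associated_sq_of_congruences (φ : A →+* F) (ψ : A →+* G) {p : ℕ} (hp : 3 ≤ p)
    {Δ k D₂ Dp f : A} (h2 : D₂ ∣ Δ) (hp' : Dp ∣ Δ)
    (h₁ : φ Δ = φ Dp ^ 2 * φ f) (h₂ : φ D₂ = φ k ^ 2 * φ f)
    (h₃ : ψ Δ = ψ D₂ ^ p * ψ f ^ (p - 1)) (h₄ : ψ Dp = ψ k ^ p * ψ f ^ (p - 1))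
    (hne : ψ Δ ≠ 0) (hnu : ¬ IsUnit (ψ Δ)) (hne' : φ Δ ≠ 0) (hnu' : ¬ IsUnit (φ Δ))
    {g : A} (hg : Irreducible g) : ¬ Associated Δ (g ^ 2) := by
  intro hgΔ
  have hgp := UniqueFactorizationMonoid.irreducible_iff_prime.1 hg
  have hψ : Associated (ψ Δ) (ψ g ^ 2) := by simpa using hgΔ.map ψ
  have hψ0 : ψ g ≠ 0 := by
    intro h0
    rw [h0, zero_pow two_ne_zero, associated_zero_iff_eq_zero] at hψ
    exact hne hψ
  have hψu : ¬ IsUnit (ψ g) := fun h => hnu (hψ.symm.isUnit (h.pow 2))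
  have key : ¬ ψ g ^ 2 * ψ g ∣ ψ g ^ 2 := by
    intro h
    have h' : ψ g ^ 2 * ψ g ∣ ψ g ^ 2 * 1 := by simpa using h
    exact hψu (isUnit_of_dvd_one ((mul_dvd_mul_iff_left (pow_ne_zero 2 hψ0)).1 h'))
  obtain ⟨i, hi, hDi⟩ := (dvd_prime_pow hgp 2).1 (h2.trans hgΔ.dvd)
  obtain ⟨j, hj, hDj⟩ := (dvd_prime_pow hgp 2).1 (hp'.trans hgΔ.dvd)
  have hD₂ : IsUnit D₂ := by
    interval_cases i
    · simpa using hDi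
    · exfalso
      apply key
      have h₅ : ψ g ∣ ψ D₂ := by simpa using map_dvd ψ hDi.symm.dvd
      calc ψ g ^ 2 * ψ g = ψ g ^ 3 := by ring
        _ ∣ ψ D₂ ^ 3 := pow_dvd_pow_of_dvd h₅ 3
        _ ∣ ψ D₂ ^ p := pow_dvd_pow _ hp
        _ ∣ ψ Δ := h₃ ▸ dvd_mul_right _ _
        _ ∣ ψ g ^ 2 := hψ.dvd
    · exact absurd (isUnit_map_of_eq_pow_mul ψ (by omega) (hDi.trans hgΔ.symm) h₃ hne) hnu
  have hf : IsUnit (φ f) := isUnit_of_dvd_unit (h₂ ▸ dvd_mul_left _ _) (hD₂.map φ)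
  interval_cases j
  · have : IsUnit Dp := by simpa using hDj
    exact hnu' (h₁ ▸ ((this.map φ).pow 2).mul hf)
  -- The case in which `Dp` is associated to `g`: as `D₂` is a unit, `h₃` and `h₄` show that `ψ Δ`,
  -- a square of `ψ g` up to units, divides `ψ g`.
  · have h₅ : ψ Δ ∣ ψ Dp := by
      rw [h₃, h₄]
      exact mul_dvd_mul (((hD₂.map ψ).pow p).dvd) dvd_rfl
    have h₆ : ψ Dp ∣ ψ g := by simpa using map_dvd ψ hDj.dvd
    have h₇ : ψ g * ψ g ∣ ψ g * 1 := by
      rw [← pow_two, mul_one]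
      exact hψ.symm.dvd.trans (h₅.trans h₆)
    exact hψu (isUnit_of_dvd_one ((mul_dvd_mul_iff_left hψ0).1 h₇))
  · exact hnu' (isUnit_map_of_eq_pow_mul φ le_rfl (hDj.trans hgΔ.symm) h₁ hne')

end Congruences
end VirtualKnots

namespace VirtualKnots

/-! ### Norms from roots of unity as resultants with cyclotomic polynomials. -/

section CyclotomicNorm
open Polynomial

/-- The product of the values of `B` at the primitive `d`-th roots of unity. -/
noncomputable def cyclotomicNorm {R : Type*} [CommRing R] (d : ℕ) (B : R[X]) : R :=
  resultant (cyclotomic d R) B (Nat.totient d) B.natDegree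

/-- The formal degrees in the resultant are fixed in advance, so it commutes with `φ` even if the
degree of `B` drops. -/
theorem map_cyclotomicNorm {R S : Type*} [CommRing R] [CommRing S] (φ : R →+* S) (d : ℕ)
    (B : R[X]) : φ (cyclotomicNorm d B)
      = resultant (cyclotomic d S) (B.map φ) (Nat.totient d) B.natDegree := by
  rw [cyclotomicNorm, ← resultant_map_map, map_cyclotomic]

theorem cyclotomicNorm_two {R : Type*} [CommRing R] (B : R[X]) :
    cyclotomicNorm 2 B = B.eval (-1) := by
  have h : (cyclotomic 2 R) = X - C (-1) := by simp
  rw [cyclotomicNorm, h, Nat.totient_two, resultant_X_sub_C_left _ _ _ le_rfl]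

/-- In characteristic `p` all primitive `p`-th roots of unity collapse to 1: Φ_p = (X - 1)^{p-1}.
The next two lemmas use Φ_{2p} = (X + 1)^{p-1} in characteristic `p` and Φ_{2p} = Φ_p in
characteristic 2. -/
theorem map_cyclotomicNorm_prime {R S : Type*} [CommRing R] [CommRing S] (φ : R →+* S) {p : ℕ}
    (hp : p.Prime) [CharP S p] (B : R[X]) :
    φ (cyclotomicNorm p B) = φ (B.eval 1) ^ (p - 1) := by
  have := Fact.mk hp
  have h : cyclotomic p S = (X - C 1) ^ (p - 1) := by
    have := cyclotomic_mul_prime_eq_pow_of_not_dvd S (p := p) (n := 1) (by simp [hp.one_lt.ne'])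
    simpa using this
  rw [map_cyclotomicNorm, h, Nat.totient_prime hp,
    resultant_X_sub_C_pow_left _ _ _ _ natDegree_map_le, eval_one_map]

theorem map_cyclotomicNorm_two_mul_prime {R S : Type*} [CommRing R] [CommRing S] (φ : R →+* S)
    {p : ℕ} (hp : p.Prime) (hp' : p ≠ 2) [CharP S p] (B : R[X]) :
    φ (cyclotomicNorm (2 * p) B) = φ (B.eval (-1)) ^ (p - 1) := by
  have := Fact.mk hp
  have h : cyclotomic (2 * p) S = (X - C (-1)) ^ (p - 1) := by
    rw [cyclotomic_mul_prime_eq_pow_of_not_dvd S (p := p) (n := 2)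
      (fun h => hp' ((Nat.prime_dvd_prime_iff_eq hp Nat.prime_two).1 h))]
    simp
  have ht : Nat.totient (2 * p) = p - 1 := by
    rw [Nat.totient_mul ((Nat.coprime_primes Nat.prime_two hp).2 (Ne.symm hp')), Nat.totient_two,
      one_mul, Nat.totient_prime hp]
  rw [map_cyclotomicNorm, h, ht, resultant_X_sub_C_pow_left _ _ _ _ natDegree_map_le]
  congr 1
  rw [← map_one φ, ← map_neg, eval_map_apply]

theorem map_cyclotomicNorm_two_mul {R S : Type*} [CommRing R] [CommRing S] (φ : R →+* S)
    {p : ℕ} (hp : p.Prime) (hp' : p ≠ 2) [CharP S 2] (B : R[X]) :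
    φ (cyclotomicNorm (2 * p) B) = φ (cyclotomicNorm p B) := by
  have := Fact.mk Nat.prime_two
  have h : cyclotomic (2 * p) S = cyclotomic p S := by
    rw [mul_comm, cyclotomic_mul_prime_eq_pow_of_not_dvd S (p := 2) (n := p)
      (fun h => hp' ((Nat.prime_dvd_prime_iff_eq Nat.prime_two hp).1 h).symm)]
    simp
  have ht : Nat.totient (2 * p) = Nat.totient p := by
    rw [Nat.totient_mul ((Nat.coprime_primes Nat.prime_two hp).2 (Ne.symm hp')), Nat.totient_two,
      one_mul]
  rw [map_cyclotomicNorm, map_cyclotomicNorm, h, ht]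

/-- The nontrivial roots of unity are sorted by their order. Both factorizations of 1 + X + ⋯ + X^n,
into linear factors and into cyclotomic polynomials, are inserted into the multiplicative resultant
with `B`. -/
theorem prod_eval_pow_eq_prod_cyclotomicNorm {R L : Type*} [CommRing R] [CommRing L] [IsDomain L]
    (φ : R →+* L) {n : ℕ} {ζ : L} (hζ : IsPrimitiveRoot ζ (n + 1)) (B : R[X]) :
    ∏ k ∈ Finset.range n, (B.map φ).eval (ζ ^ (k + 1))
      = φ (∏ d ∈ (n + 1).divisors.erase 1, cyclotomicNorm d B) := by
  have h₁ : ∏ k ∈ Finset.range n, (X - C (ζ ^ (k + 1)))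
      = ∏ d ∈ (n + 1).divisors.erase 1, cyclotomic d L := by
    rw [prod_cyclotomic_eq_geom_sum n.succ_pos]
    have h := X_pow_sub_C_eq_prod hζ n.zero_lt_succ (one_pow (n + 1))
    rw [C_1, ← mul_geom_sum] at h
    simp only [mul_one, Finset.prod_range_succ', pow_zero, C_1] at h
    rw [mul_comm] at h
    exact (mul_right_cancel₀ (X_sub_C_ne_zero 1) h).symm
  have h₂ := resultant_prod_left (Finset.range n) (fun k => X - C (ζ ^ (k + 1))) (B.map φ)
    B.natDegree (by simp only [leadingCoeff_X_sub_C]; simp) natDegree_map_le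
  have h₃ := resultant_prod_left ((n + 1).divisors.erase 1) (fun d => cyclotomic d L) (B.map φ)
    B.natDegree (by simp [(cyclotomic.monic _ L).leadingCoeff]) natDegree_map_le
  rw [map_prod]
  simp only [map_cyclotomicNorm]
  rw [h₁, h₃] at h₂
  simp only [natDegree_cyclotomic, natDegree_X_sub_C] at h₂
  rw [h₂]
  exact Finset.prod_congr rfl fun k _ => (resultant_X_sub_C_left _ _ _ natDegree_map_le).symm

end CyclotomicNorm
end VirtualKnots

namespace VirtualKnots

/-! ### Adjugates of singular matrices and determinants of block circulant matrices. -/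

section BlockCirculant
open Polynomial

variable {ι : Type*} [Fintype ι] [DecidableEq ι]

/-- The determinant of a rank one perturbation of a matrix whose rows sum to zero. -/
theorem det_add_vecMulVec_of_mulVec_one {R : Type*} [CommRing R] {M : Matrix ι ι R}
    (hM : ∀ i, ∑ j, M i j = 0) (b c : ι → R) (j : ι) :
    (M + Matrix.vecMulVec b c).det = (∑ k, c k) * ∑ i, M.adjugate j i * b i := by
  -- Adding all columns to column `j` leaves there only the perturbation, because the rows of `M`
  -- sum to zero.
  have h₁ : (M + Matrix.vecMulVec b c).det
      = ((M + Matrix.vecMulVec b c).updateCol j ((∑ k, c k) • b)).det := by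
    have h := Matrix.det_updateCol_sum (M + Matrix.vecMulVec b c) j 1
    rw [Pi.one_apply, one_smul] at h
    rw [← h]
    congr 2
    ext i
    simp [Matrix.vecMulVec_apply, Finset.sum_add_distrib, hM, ← Finset.mul_sum, mul_comm]
  -- With `b` as column `j`, multiples of it clear the perturbation from the other columns.
  have h₂ : ((M + Matrix.vecMulVec b c).updateCol j b).det = (M.updateCol j b).det := by
    rw [← Matrix.det_transpose, ← Matrix.det_transpose (M.updateCol j b)]
    refine Matrix.det_eq_of_forall_row_eq_smul_add_const (fun i => if i = j then 0 else c i) j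
      (if_pos rfl) fun i k => ?_
    by_cases h : i = j
    · simp [h]
    · simp [h, Matrix.vecMulVec_apply, mul_comm]
  rw [h₁, Matrix.det_updateCol_smul, h₂, ← Matrix.cramer_apply, Matrix.cramer_eq_adjugate_mulVec]
  rfl

/-- The column `b` below is chosen orthogonal to `v`. Hence `v` still annihilates `M` with column
`j` replaced by `b`, and by Cramer's rule the vanishing determinant is the asserted identity. -/
theorem adjugate_mul_eq_of_vecMul_eq_zero {R : Type*} [CommRing R] [IsDomain R] {M : Matrix ι ι R}
    {v : ι → R} (hv : Matrix.vecMul v M = 0) (hv0 : v ≠ 0) (j i i' : ι) :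
    M.adjugate j i * v i' = M.adjugate j i' * v i := by
  let b : ι → R := v i' • Pi.single i 1 - v i • Pi.single i' 1
  have h : (M.updateCol j b).det = 0 := by
    rw [← Matrix.exists_vecMul_eq_zero_iff]
    refine ⟨v, hv0, ?_⟩
    ext k
    by_cases hk : k = j
    · simp [hk, Matrix.vecMul, dotProduct, b, mul_sub, Finset.sum_sub_distrib, Pi.single_apply,
        mul_comm]
    · have := congrFun hv k
      simpa [Matrix.vecMul, dotProduct, Matrix.updateCol_apply, hk] using this
  rw [← Matrix.cramer_apply, Matrix.cramer_eq_adjugate_mulVec] at h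
  simp only [b, Matrix.mulVec_sub, Matrix.mulVec_smul, Matrix.mulVec_single_one, Pi.sub_apply,
    Pi.smul_apply, smul_eq_mul, Matrix.col_apply] at h
  linear_combination h

theorem adjugate_eq_of_row_sum_eq_zero {R : Type*} [CommRing R] [IsDomain R] {M : Matrix ι ι R}
    (hM : ∀ i, ∑ j, M i j = 0) (j j' i : ι) : M.adjugate j i = M.adjugate j' i := by
  have h := adjugate_mul_eq_of_vecMul_eq_zero (M := M.transpose) (v := 1) (by
    ext i; simpa [Matrix.vecMul, dotProduct] using hM i)
    (fun h => one_ne_zero (congrFun h i)) i j j'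
  simpa [← Matrix.adjugate_transpose] using h

variable {n : ℕ}

/-- The block circulant matrix with blocks `c · · 0, …, c · · n`. -/
def blockCirculant {R : Type*} (c : ι → ι → Fin (n + 1) → R) :
    Matrix (ι × Fin (n + 1)) (ι × Fin (n + 1)) R :=
  Matrix.of fun x y => c x.1 y.1 (y.2 - x.2)

/-- The symbol of a block circulant matrix. -/
noncomputable def symbol {R : Type*} [CommRing R] (c : ι → ι → Fin (n + 1) → R) :
    Matrix ι ι R[X] :=
  Matrix.of fun i j => ∑ b, C (c i j b) * X ^ (b : ℕ)

theorem pow_fin_add_val {L : Type*} [CommRing L] {ζ : L} (hζ : ζ ^ (n + 1) = 1)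
    (a b : Fin (n + 1)) : ζ ^ ((a + b : Fin (n + 1)) : ℕ) = ζ ^ (a : ℕ) * ζ ^ (b : ℕ) := by
  rw [Fin.val_add, ← pow_eq_pow_mod _ hζ, pow_add]

/-- The discrete Fourier transform, a Vandermonde matrix acting on the `Fin (n + 1)` coordinate,
intertwines the block circulant matrix with the block diagonal matrix of the values of the symbol at
the powers of `ζ`. It has nonzero determinant because `ζ` is primitive, so it cancels. -/
theorem det_blockCirculant {L : Type*} [CommRing L] [IsDomain L] {ζ : L}
    (hζ : IsPrimitiveRoot ζ (n + 1)) (c : ι → ι → Fin (n + 1) → L) :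
    (blockCirculant c).det
      = ∏ k ∈ Finset.range (n + 1), ((symbol c).map (eval (ζ ^ k))).det := by
  let V : Matrix (Fin (n + 1)) (Fin (n + 1)) L :=
    Matrix.vandermonde fun a : Fin (n + 1) => ζ ^ (a : ℕ)
  have hV : V.det ≠ 0 := by
    rw [Matrix.det_vandermonde_ne_zero_iff]
    intro a b hab
    exact Fin.ext (hζ.pow_inj a.2 b.2 hab)
  let Φ : Matrix (ι × Fin (n + 1)) (ι × Fin (n + 1)) L := Matrix.kroneckerMap (· * ·) 1 V
  have hΦ : Φ.det ≠ 0 := by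
    rw [Matrix.det_kronecker, Matrix.det_one, one_pow, one_mul]
    exact pow_ne_zero _ hV
  have h : blockCirculant c * Φ = Φ * Matrix.blockDiagonal
      fun k : Fin (n + 1) => (symbol c).map (eval (ζ ^ (k : ℕ))) := by
    ext ⟨i, a⟩ ⟨j, k⟩
    rw [Matrix.mul_apply, Matrix.mul_apply, Fintype.sum_prod_type, Fintype.sum_prod_type]
    have hk : (ζ ^ (k : ℕ)) ^ (n + 1) = 1 := by rw [← pow_mul, mul_comm, pow_mul, hζ.pow_eq_one, one_pow]
    simp only [blockCirculant, Φ, V, Matrix.of_apply, Matrix.kroneckerMap_apply, Matrix.one_apply,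
      Matrix.vandermonde_apply, Matrix.blockDiagonal_apply, symbol, Matrix.map_apply, ite_mul,
      mul_ite, one_mul, zero_mul, mul_zero, eval_finsetSum, eval_mul, eval_C, eval_pow, eval_X]
    rw [Finset.sum_eq_single j (by intro b _ hb; simp [hb]) (by simp),
      Finset.sum_eq_single i (by intro b _ hb; simp [Ne.symm hb]) (by simp)]
    simp only [if_true, Finset.sum_ite_eq', Finset.mem_univ]
    rw [← Equiv.sum_comp (Equiv.addRight a), Finset.mul_sum]
    refine Finset.sum_congr rfl fun b _ => ?_
    have e : ∀ d : Fin (n + 1), (ζ ^ (d : ℕ)) ^ (k : ℕ) = (ζ ^ (k : ℕ)) ^ (d : ℕ) := fun d => by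
      rw [← pow_mul, mul_comm, pow_mul]
    rw [Equiv.coe_addRight, add_sub_cancel_right, e, e, pow_fin_add_val hk]
    ring
  have hdet := congrArg Matrix.det h
  rw [Matrix.det_mul, Matrix.det_mul, Matrix.det_blockDiagonal, mul_comm] at hdet
  rw [mul_left_cancel₀ hΦ hdet]
  exact (Finset.prod_range fun k => ((symbol c).map (eval (ζ ^ k))).det).symm

end BlockCirculant
end VirtualKnots

namespace VirtualKnots

/-! ### The factorization of the Alexander polynomial of a block circulant matrix. -/

section PeriodicFactorization
open Polynomial

variable {ι : Type*} [Fintype ι] [DecidableEq ι] {n : ℕ}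

theorem adjugate_blockCirculant_shift {R : Type*} [CommRing R] (c : ι → ι → Fin (n + 1) → R)
    (x : ι × Fin (n + 1)) (i : ι) (a b : Fin (n + 1)) :
    (blockCirculant c).adjugate (x.1, x.2 + b) (i, a + b) = (blockCirculant c).adjugate x (i, a) := by
  let e : ι × Fin (n + 1) ≃ ι × Fin (n + 1) := Equiv.prodCongr (Equiv.refl ι) (Equiv.subRight b)
  have h : Matrix.reindex e e (blockCirculant c) = blockCirculant c := by
    ext y z
    simp [e, blockCirculant]
  have h' := Matrix.adjugate_reindex e (blockCirculant c)
  rw [h] at h'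
  have := congrFun (congrFun h' x) (i, a)
  rw [this]
  rfl

omit [DecidableEq ι] in
/-- A vector with no common divisor except units divides every proportional vector. -/
theorem exists_eq_mul_of_proportional {R : Type*} [CommRing R] [IsDomain R]
    [UniqueFactorizationMonoid R] {v u : ι → R} (hv : ∀ d, (∀ i, d ∣ v i) → IsUnit d)
    (huv : ∀ i j, u i * v j = u j * v i) : ∃ k, ∀ i, u i = k * v i := by
  classical
  by_cases hv0 : ∃ i, v i ≠ 0
  · obtain ⟨i₀, hi₀⟩ := hv0
    let _ : StrongNormalizationMonoid R := UniqueFactorizationMonoid.strongNormalizationMonoid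
    let _ := UniqueFactorizationMonoid.toStrongNormalizedGCDMonoid R
    let g := Finset.univ.gcd v
    have hg : IsUnit g := hv g fun i => Finset.gcd_dvd (Finset.mem_univ i)
    -- By proportionality `v i₀` divides every `u i₀ * v i`, hence `u i₀` times the greatest common
    -- divisor of `v`, which is a unit.
    have h : v i₀ ∣ Finset.univ.gcd fun i => u i₀ * v i :=
      Finset.dvd_gcd fun i _ => ⟨u i, by rw [huv, mul_comm]⟩
    rw [Finset.gcd_mul_left] at h
    have h' : v i₀ ∣ u i₀ := by
      refine (hg.dvd_mul_right.1 h).trans ?_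
      exact (normalize_associated _).dvd
    obtain ⟨k, hk⟩ := h'
    refine ⟨k, fun i => mul_right_cancel₀ hi₀ ?_⟩
    rw [huv, hk]
    ring
  · push Not at hv0
    have := hv 0 (fun i => by simp [hv0])
    have h01 : (1 : R) = 0 := (isUnit_zero_iff.1 this).symm
    exact ⟨0, fun i => by rw [← mul_one (u i), h01]; simp⟩

/-- The row sums of the symbol vanish at `X = 1`, so they are `(1 - X) * r i`. Adding all columns to
column `j` extracts `1 - X`; the remaining determinant at `X = 1` is expanded by Cramer's rule. -/
theorem det_symbol_eq {R : Type*} [CommRing R] [Nonempty ι] {c : ι → ι → Fin (n + 1) → R}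
    (hrow : ∀ i, ∑ j, ∑ b, c i j b = 0) (j : ι) :
    ∃ (r : ι → R[X]) (B : R[X]), (symbol c).det = (1 - X) * B ∧
      B.eval 1 = ∑ i, ((symbol c).map (eval 1)).adjugate j i * (r i).eval 1 := by
  have h : ∀ i, ∃ r : R[X], ∑ k, symbol c i k = (1 - X) * r := by
    intro i
    have hd : X - C 1 ∣ ∑ k, symbol c i k := by
      rw [dvd_iff_isRoot, IsRoot.def, eval_finsetSum]
      simpa [symbol, eval_finsetSum] using hrow i
    obtain ⟨r, hr⟩ := hd
    exact ⟨-r, by rw [hr, C_1]; ring⟩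
  choose r hr using h
  refine ⟨r, ((symbol c).updateCol j r).det, ?_, ?_⟩
  · have h := Matrix.det_updateCol_sum (symbol c) j 1
    rw [Pi.one_apply, one_smul] at h
    rw [← smul_eq_mul, ← h, smul_eq_mul, ← Matrix.det_updateCol_smul]
    congr 2
    ext1 i
    simp [← hr]
  · rw [← coe_evalRingHom, RingHom.map_det, RingHom.mapMatrix_apply, Matrix.map_updateCol,
      ← Matrix.cramer_apply, Matrix.cramer_eq_adjugate_mulVec]
    rfl

omit [Fintype ι] [DecidableEq ι] in
theorem symbol_map {R S : Type*} [CommRing R] [CommRing S] (φ : R →+* S)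
    (c : ι → ι → Fin (n + 1) → R) :
    symbol (fun i j b => φ (c i j b)) = (symbol c).map (Polynomial.map φ) := by
  ext1 i j
  simp [symbol, Polynomial.map_sum]

/-- The adjugates of a block circulant matrix and of the sum of its blocks differ by the values of
the determinant of the symbol at the nontrivial roots of unity. -/
theorem adjugate_blockCirculant_eq {R : Type*} [CommRing R] [IsDomain R] [CharZero R]
    {c : ι → ι → Fin (n + 1) → R} (hrow : ∀ i, ∑ j, ∑ b, c i j b = 0)
    {B : R[X]} (hB : (symbol c).det = (1 - X) * B) (x : ι × Fin (n + 1)) (j i : ι) :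
    (blockCirculant c).adjugate x (i, 0) = ((symbol c).map (eval 1)).adjugate j i
      * ∏ d ∈ (n + 1).divisors.erase 1, cyclotomicNorm d B := by
  -- The identity is proved in a field that contains a primitive root of unity; `φ` is injective, so
  -- it descends to `R`.
  let L := AlgebraicClosure (FractionRing R)
  let φ : R →+* L := (algebraMap (FractionRing R) L).comp (algebraMap R (FractionRing R))
  have hφ : Function.Injective φ :=
    (algebraMap (FractionRing R) L).injective.comp (IsFractionRing.injective R _)
  have : CharZero (FractionRing R) :=
    charZero_of_injective_ringHom (IsFractionRing.injective R (FractionRing R))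
  have : CharZero L := charZero_of_injective_ringHom hφ
  obtain ⟨ζ, hζ⟩ := HasEnoughRootsOfUnity.exists_primitiveRoot L (n + 1)
  -- The block circulant matrix is singular, so it is perturbed: every entry of the block at `i`,
  -- `j` is increased by 1. This is a rank one change, so the new determinant sees the adjugate; it
  -- is still block circulant, so its determinant is also a product over roots of unity.
  let c' : ι → ι → Fin (n + 1) → L := fun i' j' b =>
    φ (c i' j' b) + (if i' = i then 1 else 0) * (if j' = j then 1 else 0)
  have hw : ∀ a, (blockCirculant c).adjugate x (i, a) = (blockCirculant c).adjugate x (i, 0) := by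
    intro a
    have h := adjugate_blockCirculant_shift c x i 0 a
    rw [zero_add] at h
    rw [← h]
    refine adjugate_eq_of_row_sum_eq_zero (fun y => ?_) _ _ _
    rw [Fintype.sum_prod_type, ← hrow y.1]
    refine Finset.sum_congr rfl fun k _ => ?_
    exact Equiv.sum_comp (Equiv.subRight y.2) (c y.1 k)
  have hrow' : ∀ y, ∑ z, (blockCirculant c) y z = 0 := by
    intro y
    rw [Fintype.sum_prod_type, ← hrow y.1]
    refine Finset.sum_congr rfl fun k _ => ?_
    exact Equiv.sum_comp (Equiv.subRight y.2) (c y.1 k)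
  have h₁ : (blockCirculant c').det
      = (n + 1) * ((n + 1) * φ ((blockCirculant c).adjugate x (i, 0))) := by
    have e : blockCirculant c' = (blockCirculant c).map φ
        + Matrix.vecMulVec (fun y => if y.1 = i then 1 else 0) (fun y => if y.1 = j then 1 else 0) :=
      rfl
    rw [e, det_add_vecMulVec_of_mulVec_one (fun y => by
      simp only [Matrix.map_apply, ← map_sum, hrow', map_zero]) _ _ x]
    have e' : ((blockCirculant c).map φ).adjugate = (blockCirculant c).adjugate.map φ :=
      (RingHom.map_adjugate φ _).symm
    have s₁ : ∑ y : ι × Fin (n + 1), (if y.1 = j then (1 : L) else 0) = n + 1 := by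
      rw [Fintype.sum_prod_type, Finset.sum_eq_single j (by intro b _ hb; simp [hb]) (by simp)]
      simp
    rw [e', s₁, Fintype.sum_prod_type, Finset.sum_eq_single i (by intro b _ hb; simp [hb]) (by simp)]
    simp [hw]
  have h₂ : ((symbol c').map (eval (ζ ^ 0))).det
      = (n + 1) * φ (((symbol c).map (eval 1)).adjugate j i) := by
    have e : (symbol c').map (eval (ζ ^ 0)) = ((symbol c).map (eval 1)).map φ
        + Matrix.vecMulVec (fun i' => if i' = i then (n + 1 : L) else 0)
          (fun j' => if j' = j then 1 else 0) := by
      ext i' j'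
      by_cases hi : i' = i <;> by_cases hj : j' = j <;>
        simp [symbol, c', eval_finsetSum, Matrix.vecMulVec_apply, Finset.sum_add_distrib, hi, hj]
    have e' : (((symbol c).map (eval 1)).map φ).adjugate
        = ((symbol c).map (eval 1)).adjugate.map φ := (RingHom.map_adjugate φ _).symm
    rw [e, det_add_vecMulVec_of_mulVec_one (fun i' => by
      simp only [Matrix.map_apply, ← map_sum, symbol, Matrix.of_apply, eval_finsetSum]
      simpa using congrArg φ (hrow i')) _ _ j, e']
    simp [mul_comm]
  -- The perturbation adds 1 + X + ⋯ + X^n to one entry of the symbol, which vanishes at the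
  -- nontrivial roots of unity.
  have h₃ : ∀ k ∈ Finset.range n, ((symbol c').map (eval (ζ ^ (k + 1)))).det
      = (1 - ζ ^ (k + 1)) * (B.map φ).eval (ζ ^ (k + 1)) := by
    intro k hk
    have hne : ζ ^ (k + 1) ≠ 1 :=
      hζ.pow_ne_one_of_pos_of_lt k.succ_ne_zero (by simpa using hk)
    have hgeom : ∑ b : Fin (n + 1), (ζ ^ (k + 1)) ^ (b : ℕ) = 0 := by
      rw [Fin.sum_univ_eq_sum_range fun b => (ζ ^ (k + 1)) ^ b]
      have := mul_geom_sum (ζ ^ (k + 1)) (n + 1)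
      rw [← pow_mul, mul_comm (k + 1), pow_mul, hζ.pow_eq_one, one_pow, sub_self] at this
      exact (mul_eq_zero.1 this).resolve_left (sub_ne_zero.2 hne)
    have e : (symbol c').map (eval (ζ ^ (k + 1)))
        = (symbol fun i j b => φ (c i j b)).map (eval (ζ ^ (k + 1))) := by
      ext i' j'
      simp [symbol, c', eval_finsetSum, add_mul, Finset.sum_add_distrib, ← Finset.mul_sum, hgeom]
    rw [e, symbol_map, ← coe_evalRingHom, ← RingHom.mapMatrix_apply, ← RingHom.map_det,
      ← Polynomial.coe_mapRingHom, ← RingHom.mapMatrix_apply, ← RingHom.map_det, hB]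
    simp
  have h := det_blockCirculant hζ c'
  -- The product of the factors `1 - ζ ^ (k + 1)` is `n + 1`. With the factor in `h₂` it matches the
  -- two factors `n + 1` in `h₁`.
  rw [Finset.prod_range_succ', Finset.prod_congr rfl h₃, Finset.prod_mul_distrib,
    hζ.prod_one_sub_pow_eq_order, prod_eval_pow_eq_prod_cyclotomicNorm φ hζ, h₁, h₂] at h
  have hn : (n + 1 : L) ≠ 0 := by exact_mod_cast n.succ_ne_zero
  apply hφ
  apply mul_left_cancel₀ hn
  apply mul_left_cancel₀ hn
  rw [h, map_mul]
  ring

/-- Vanishing row sums and the cyclic symmetry make an adjugate entry depend only on the orbit of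
its column index, so the entries are `Δ * v i` with `v` primitive. As `v` annihilates the sum `A` of
the blocks, row `j` of the adjugate of `A` is proportional to `v`; the factor of proportionality is
`k`. -/
theorem exists_factorization_of_blockCirculant {R : Type*} [CommRing R] [IsDomain R]
    [UniqueFactorizationMonoid R] [CharZero R] [Nonempty ι]
    {c : ι → ι → Fin (n + 1) → R} (hrow : ∀ i, ∑ j, ∑ b, c i j b = 0) {Δ : R} (hΔ : Δ ≠ 0)
    (h₁ : adjIdeal (blockCirculant c) ≤ Ideal.span {Δ})
    (h₂ : ∀ d, adjIdeal (blockCirculant c) ≤ Ideal.span {d} → Ideal.span {Δ} ≤ Ideal.span {d}) :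
    ∃ (k f : R) (B : R[X]), B.eval 1 = k * f ∧
      Δ = k * ∏ d ∈ (n + 1).divisors.erase 1, cyclotomicNorm d B := by
  obtain ⟨j⟩ := ‹Nonempty ι›
  obtain ⟨r, B, hB, hB₁⟩ := det_symbol_eq hrow j
  set P := ∏ d ∈ (n + 1).divisors.erase 1, cyclotomicNorm d B
  set A := (symbol c).map (eval 1) with hA
  have hrow' : ∀ y, ∑ z, (blockCirculant c) y z = 0 := by
    intro y
    rw [Fintype.sum_prod_type, ← hrow y.1]
    refine Finset.sum_congr rfl fun k _ => ?_
    exact Equiv.sum_comp (Equiv.subRight y.2) (c y.1 k)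
  have hw : ∀ x i a, (blockCirculant c).adjugate x (i, a)
      = (blockCirculant c).adjugate (j, 0) (i, 0) := by
    intro x i a
    have h := adjugate_blockCirculant_shift c (j, 0) i 0 a
    rw [zero_add] at h
    rw [← h]
    exact adjugate_eq_of_row_sum_eq_zero hrow' _ _ _
  have hdvd : ∀ i, Δ ∣ (blockCirculant c).adjugate (j, 0) (i, 0) := fun i =>
    Ideal.mem_span_singleton.1 (h₁ (adjugate_mem_adjIdeal _ _ _))
  choose v hv using hdvd
  -- A common divisor `d` of `v` would make `Δ * d` a generator of a principal ideal that still
  -- contains all entries, against minimality.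
  have hprim : ∀ d, (∀ i, d ∣ v i) → IsUnit d := by
    intro d hd
    have h := h₂ (Δ * d) (by
      rw [adjIdeal_le_iff]
      rintro x ⟨i, a⟩
      rw [hw, hv, Ideal.mem_span_singleton]
      exact mul_dvd_mul_left _ (hd i))
    rw [Ideal.span_singleton_le_span_singleton] at h
    have h' : Δ * d ∣ Δ * 1 := by simpa using h
    exact isUnit_of_dvd_one ((mul_dvd_mul_iff_left hΔ).1 h')
  have hv0 : v ≠ 0 := by
    rintro rfl
    exact not_isUnit_zero (hprim 0 fun i => dvd_rfl)
  -- The product of the adjugate with the singular matrix is zero; summing over the cyclic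
  -- coordinate turns the blocks into their sum.
  have hvA : Matrix.vecMul v A = 0 := by
    have hdet : (blockCirculant c).det = 0 :=
      Matrix.exists_mulVec_eq_zero_iff.1 ⟨1, fun h => one_ne_zero (congrFun h (j, 0)), by
        ext y; simpa [Matrix.mulVec, dotProduct] using hrow' y⟩
    have h := Matrix.adjugate_mul (blockCirculant c)
    rw [hdet, zero_smul] at h
    ext k
    have h' := congrFun (congrFun h (j, 0)) (k, 0)
    rw [Matrix.mul_apply, Fintype.sum_prod_type] at h'
    simp only [hw, hv, mul_assoc, ← Finset.mul_sum] at h'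
    have h'' := (mul_eq_zero.1 h').resolve_left hΔ
    refine Eq.trans ?_ h''
    simp only [Matrix.vecMul, dotProduct, hA, Matrix.map_apply, symbol, Matrix.of_apply,
      eval_finsetSum, eval_mul, eval_C, eval_pow, eval_X, one_pow, mul_one, blockCirculant]
    refine Finset.sum_congr rfl fun i _ => ?_
    congr 1
    exact (Equiv.sum_comp (Equiv.subLeft 0) (c i k)).symm
  obtain ⟨k, hk⟩ := exists_eq_mul_of_proportional hprim
    (adjugate_mul_eq_of_vecMul_eq_zero hvA hv0 j)
  refine ⟨k, ∑ i, v i * (r i).eval 1, B, ?_, ?_⟩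
  · rw [hB₁, Finset.mul_sum]
    exact Finset.sum_congr rfl fun i _ => by rw [hk, mul_assoc]
  · obtain ⟨i, hi⟩ := Function.ne_iff.1 hv0
    have h := adjugate_blockCirculant_eq hrow hB (j, 0) j i
    rw [hv, hk] at h
    apply mul_right_cancel₀ hi
    rw [h]
    ring

end PeriodicFactorization
end VirtualKnots

namespace VirtualKnots

/-! ### From a free cyclic symmetry of a matrix to the congruences. -/

section CyclicSymmetry

/-- A free action of a finite cyclic group, generated by `σ`, is a disjoint union of copies of the
group. -/
theorem exists_equiv_prod_fin {α : Type*} [Finite α] (σ : Equiv.Perm α) {n : ℕ}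
    (hσ : ∀ (k : ℕ) (x : α), (σ ^ k) x = x ↔ n + 1 ∣ k) :
    ∃ f : Quotient (Equiv.Perm.SameCycle.setoid σ) × Fin (n + 1) ≃ α,
      ∀ i a b, f (i, a + b) = (σ ^ (b : ℕ)) (f (i, a)) := by
  have hmod : ∀ (k : ℕ) (x : α), (σ ^ (k % (n + 1))) x = (σ ^ k) x := by
    intro k x
    conv_rhs => rw [← Nat.mod_add_div k (n + 1), pow_add, Equiv.Perm.mul_apply,
      (hσ _ x).2 (dvd_mul_right _ _)]
  let F : Quotient (Equiv.Perm.SameCycle.setoid σ) × Fin (n + 1) → α :=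
    fun y => (σ ^ (y.2 : ℕ)) y.1.out
  have hF : Function.Bijective F := by
    constructor
    · rintro ⟨i, a⟩ ⟨j, b⟩ h
      have hij : i = j := by
        rw [← Quotient.out_eq i, ← Quotient.out_eq j]
        refine Quotient.sound (s := Equiv.Perm.SameCycle.setoid σ) ?_
        change σ.SameCycle _ _
        have h' : (σ ^ (a : ℕ)) i.out = (σ ^ (b : ℕ)) j.out := h
        rw [← Equiv.Perm.sameCycle_pow_left (n := (a : ℕ)), h', Equiv.Perm.sameCycle_pow_left]
      subst hij
      have h' : (σ ^ (a : ℕ)) i.out = (σ ^ (b : ℕ)) i.out := h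
      have key : ∀ a b : Fin (n + 1), (σ ^ (a : ℕ)) i.out = (σ ^ (b : ℕ)) i.out → a ≤ b →
          a = b := by
        intro a b h hab
        have hab' : (a : ℕ) ≤ b := hab
        rw [← Nat.add_sub_cancel' hab', pow_add, Equiv.Perm.mul_apply] at h
        have h₁ := (hσ _ _).1 ((σ ^ (a : ℕ)).injective h).symm
        have h₂ := Nat.eq_zero_of_dvd_of_lt h₁ (by omega)
        exact Fin.ext (by omega)
      congr 1
      rcases le_total a b with hab | hab
      · exact key a b h' hab
      · exact (key b a h'.symm hab).symm
    · intro x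
      have h : σ.SameCycle (Quotient.mk (Equiv.Perm.SameCycle.setoid σ) x).out x :=
        Quotient.mk_out (s := Equiv.Perm.SameCycle.setoid σ) x
      obtain ⟨k, hk⟩ := h.exists_nat_pow_eq
      refine ⟨(Quotient.mk _ x, ⟨k % (n + 1), Nat.mod_lt _ n.succ_pos⟩), ?_⟩
      change (σ ^ (k % (n + 1))) _ = x
      rw [hmod, hk]
  refine ⟨Equiv.ofBijective F hF, fun i a b => ?_⟩
  change (σ ^ ((a + b : Fin (n + 1)) : ℕ)) i.out = (σ ^ (b : ℕ)) ((σ ^ (a : ℕ)) i.out)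
  rw [Fin.val_add, hmod, ← Equiv.Perm.mul_apply, ← pow_add, add_comm]

/-- In coordinates (orbit, position in the orbit) an invariant matrix depends only on the difference
of the positions: it is block circulant. -/
theorem exists_factorization_of_symmetric {R : Type*} [CommRing R] [IsDomain R]
    [UniqueFactorizationMonoid R] [CharZero R] {α : Type*} [Fintype α] [DecidableEq α] [Nonempty α]
    {J : Matrix α α R} (hrow : ∀ x, ∑ y, J x y = 0) {σ : Equiv.Perm α}
    (hJ : ∀ x y, J (σ x) (σ y) = J x y) {m : ℕ} (hm : 0 < m)
    (hσ : ∀ (k : ℕ) (x : α), (σ ^ k) x = x ↔ m ∣ k) {Δ : R} (hΔ : Δ ≠ 0)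
    (h₁ : adjIdeal J ≤ Ideal.span {Δ})
    (h₂ : ∀ d, adjIdeal J ≤ Ideal.span {d} → Ideal.span {Δ} ≤ Ideal.span {d}) :
    ∃ (k f : R) (B : Polynomial R), B.eval 1 = k * f ∧
      Δ = k * ∏ d ∈ m.divisors.erase 1, cyclotomicNorm d B := by
  classical
  obtain ⟨n, rfl⟩ := Nat.exists_eq_succ_of_ne_zero hm.ne'
  obtain ⟨f, hf⟩ := exists_equiv_prod_fin σ hσ
  have hJ' : ∀ (k : ℕ) x y, J ((σ ^ k) x) ((σ ^ k) y) = J x y := by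
    intro k
    induction k with
    | zero => simp
    | succ k ih => intro x y; rw [pow_succ, Equiv.Perm.mul_apply, Equiv.Perm.mul_apply, ih, hJ]
  let c := fun i j b => J (f (i, 0)) (f (j, b))
  have e : blockCirculant c = Matrix.reindex f.symm f.symm J := by
    ext ⟨i, a⟩ ⟨j, b⟩
    simp only [blockCirculant, Matrix.of_apply, c, Matrix.reindex_apply, Matrix.submatrix_apply,
      Equiv.symm_symm]
    rw [← hJ' (a : ℕ), ← hf, ← hf, zero_add, sub_add_cancel]
  have : Nonempty (Quotient (Equiv.Perm.SameCycle.setoid σ)) :=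
    ⟨Quotient.mk _ (Classical.arbitrary α)⟩
  refine exists_factorization_of_blockCirculant (c := c) (fun i => ?_) hΔ ?_ ?_
  · rw [← hrow (f (i, 0)), ← Equiv.sum_comp f, Fintype.sum_prod_type]
  · rwa [e, adjIdeal_reindex]
  · rwa [e, adjIdeal_reindex]

/-- Otherwise `p` divides the irreducible `g`, so `g` is `p` times a unit, and this is a unit modulo
2 because `p` is odd. -/
theorem reduceMod_ne_zero_of_map {p : ℕ} (hp : p.Prime) (hp' : p ≠ 2) {g : ℤ[T;T⁻¹]}
    (hg : Irreducible g) (hg2 : ¬ IsUnit (reduceMod 2 g)) : reduceMod p g ≠ 0 := by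
  intro h
  obtain ⟨u, hu⟩ := C_dvd_of_reduceMod_eq_zero h
  have hC : ∀ r, reduceMod 2 (LaurentPolynomial.C r) = LaurentPolynomial.C (r : ZMod 2) := by
    intro r
    exact AddMonoidAlgebra.mapRingHom_single _ _ _
  have hpu : IsUnit (reduceMod 2 (LaurentPolynomial.C (p : ℤ))) := by
    rw [hC]
    refine IsUnit.map _ ?_
    have := (ZMod.isUnit_iff_coprime p 2).2 ((Nat.coprime_primes hp Nat.prime_two).2 hp')
    simpa using this
  rcases hg.isUnit_or_isUnit hu with h₁ | h₁
  · rw [laurentPolynomial_isUnit_iff] at h₁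
    obtain ⟨a, j, h₁⟩ := h₁
    have h₂ := congrArg (reduceMod p) h₁
    have h₃ : reduceMod p (LaurentPolynomial.C (p : ℤ)) = 0 := by
      have : reduceMod p (LaurentPolynomial.C (p : ℤ)) = LaurentPolynomial.C ((p : ℤ) : ZMod p) :=
        AddMonoidAlgebra.mapRingHom_single _ _ _
      rw [this]; simp
    have h₄ : IsUnit (LaurentPolynomial.C (p : ℤ)) := h₁ ▸ laurentPolynomial_isUnit_iff.2 ⟨a, j, rfl⟩
    have h₅ := h₄.map (reduceMod p)
    have := Fact.mk hp
    rw [h₃, isUnit_zero_iff] at h₅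
    exact zero_ne_one h₅
  · apply hg2
    rw [hu, map_mul]
    exact hpu.mul (h₁.map _)

theorem conclusion_of_symmetric {α : Type*} [Fintype α] [DecidableEq α] [Nonempty α]
    {J : Matrix α α ℤ[T;T⁻¹]} (hrow : ∀ x, ∑ y, J x y = 0) {σ : Equiv.Perm α}
    (hJ : ∀ x y, J (σ x) (σ y) = J x y) {p : ℕ} (hp : p.Prime) (hp' : p ≠ 2)
    (hσ : ∀ (k : ℕ) (x : α), (σ ^ k) x = x ↔ 2 * p ∣ k) {Δ : ℤ[T;T⁻¹]}
    (h₁ : adjIdeal J ≤ Ideal.span {Δ})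
    (h₂ : ∀ d, adjIdeal J ≤ Ideal.span {d} → Ideal.span {Δ} ≤ Ideal.span {d})
    (hnontrivial : ¬ DotEq (reduceMod p Δ) 1) :
    ¬ (Irreducible Δ ∧ ∃ g : (ZMod 2)[T;T⁻¹], Irreducible g ∧ DotEq (reduceMod 2 Δ) (g ^ 2)) ∧
    ¬ ∃ g : ℤ[T;T⁻¹], Irreducible g ∧ Irreducible (reduceMod 2 g) ∧ DotEq Δ (g ^ 2) := by
  have := Fact.mk hp
  have := Fact.mk Nat.prime_two
  have hnu : ¬ IsUnit (reduceMod p Δ) := fun h =>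
    hnontrivial (dotEq_iff_associated.2 (associated_one_iff_isUnit.2 h))
  have hC : ∀ (R : Type) [CommRing R],
      Function.Injective (LaurentPolynomial.C : R →+* R[T;T⁻¹]) := by
    intro R _ a b h
    rw [← Polynomial.toLaurent_C, ← Polynomial.toLaurent_C] at h
    exact Polynomial.C_injective (Polynomial.toLaurent_injective h)
  have : CharP (ZMod 2)[T;T⁻¹] 2 := charP_of_injective_ringHom (hC _) 2
  have : CharP (ZMod p)[T;T⁻¹] p := charP_of_injective_ringHom (hC _) p
  have : CharZero ℤ[T;T⁻¹] := charZero_of_injective_ringHom (hC _)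
  have hp3 : 3 ≤ p := by have := hp.two_le; omega
  have congruences : Δ ≠ 0 → ∃ k D₂ Dp f : ℤ[T;T⁻¹], D₂ ∣ Δ ∧ Dp ∣ Δ ∧
      reduceMod 2 Δ = reduceMod 2 Dp ^ 2 * reduceMod 2 f ∧
      reduceMod 2 D₂ = reduceMod 2 k ^ 2 * reduceMod 2 f ∧
      reduceMod p Δ = reduceMod p D₂ ^ p * reduceMod p f ^ (p - 1) ∧
      reduceMod p Dp = reduceMod p k ^ p * reduceMod p f ^ (p - 1) := by
    intro hΔ
    obtain ⟨k, f, B, hB, hk⟩ := exists_factorization_of_symmetric hrow hJ (by omega) hσ hΔ h₁ h₂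
    have hdiv : (2 * p).divisors.erase 1 = {2, p, 2 * p} := by
      ext d
      rw [Finset.mem_erase, Nat.mem_divisors, Nat.dvd_mul]
      simp only [Nat.dvd_prime Nat.prime_two, Nat.dvd_prime hp, Finset.mem_insert,
        Finset.mem_singleton]
      constructor
      · rintro ⟨hd, ⟨a, b, (rfl | rfl), (rfl | rfl), rfl⟩, -⟩ <;> simp_all
      · rintro (h | h | h)
        · exact ⟨by omega, ⟨2, 1, by simp [h]⟩, by omega⟩
        · exact ⟨by omega, ⟨1, p, by simp [h]⟩, by omega⟩
        · exact ⟨by omega, ⟨2, p, by simp [h]⟩, by omega⟩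
    rw [hdiv, Finset.prod_insert (by simp; omega), Finset.prod_insert (by simp; omega),
      Finset.prod_singleton, cyclotomicNorm_two] at hk
    -- Modulo 2 the points 1 and -1 coincide, so `B.eval (-1)` reduces to the same element as
    -- `B.eval 1 = k * f`.
    have hB2 : reduceMod 2 (B.eval (-1)) = reduceMod 2 k * reduceMod 2 f := by
      rw [← map_mul, ← hB, ← Polynomial.eval_map_apply, ← Polynomial.eval_map_apply, map_neg,
        CharTwo.neg_eq]
    have hpow : ∀ x : (ZMod p)[T;T⁻¹], x ^ p = x ^ (p - 1) * x := fun x =>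
      (pow_sub_one_mul hp.ne_zero x).symm
    refine ⟨k, k * B.eval (-1), k * cyclotomicNorm p B, f, ⟨_, by rw [hk, mul_assoc]⟩,
      ⟨B.eval (-1) * cyclotomicNorm (2 * p) B, by rw [hk]; ring⟩, ?_, ?_, ?_, ?_⟩
    · rw [hk]
      simp only [map_mul, map_cyclotomicNorm_two_mul _ hp hp', hB2]
      ring
    · rw [map_mul, hB2]
      ring
    · rw [hk]
      simp only [map_mul, map_cyclotomicNorm_two_mul_prime _ hp hp', map_cyclotomicNorm_prime _ hp,
        hB]
      rw [hpow]
      ring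
    · simp only [map_mul, map_cyclotomicNorm_prime _ hp, hB]
      rw [hpow]
      ring
  constructor
  · rintro ⟨hΔ, g, hg, hgΔ⟩
    rw [dotEq_iff_associated] at hgΔ
    have hnu' : ¬ IsUnit (reduceMod 2 Δ) := fun h =>
      hg.not_isUnit ((isUnit_pow_iff two_ne_zero).1 (hgΔ.isUnit h))
    have hne' : reduceMod 2 Δ ≠ 0 := by
      intro h
      rw [h] at hgΔ
      exact pow_ne_zero 2 hg.ne_zero ((associated_zero_iff_eq_zero _).1 hgΔ.symm)
    obtain ⟨k, D₂, Dp, f, hD₂, hDp, c₁, c₂, c₃, -⟩ := congruences hΔ.ne_zero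
    exact Irreducible.not_of_congruences _ _ hp.two_le hD₂ hDp c₁ c₂ c₃
      (reduceMod_ne_zero_of_map hp hp' hΔ hnu') hnu hne' hnu' hΔ
  · rintro ⟨g, hg, hg2, hgΔ⟩
    rw [dotEq_iff_associated] at hgΔ
    have hass : ∀ m, Associated (reduceMod m Δ) (reduceMod m g ^ 2) := fun m => by
      simpa using hgΔ.map (reduceMod m)
    have hne : ∀ m, [Fact m.Prime] → reduceMod m g ≠ 0 → reduceMod m Δ ≠ 0 := by
      intro m _ h h'
      have := hass m
      rw [h'] at this
      exact pow_ne_zero 2 h ((associated_zero_iff_eq_zero _).1 this.symm)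
    have hΔ : Δ ≠ 0 := fun h => hne 2 hg2.ne_zero (by rw [h, map_zero])
    obtain ⟨k, D₂, Dp, f, hD₂, hDp, c₁, c₂, c₃, c₄⟩ := congruences hΔ
    refine not_associated_sq_of_congruences _ _ hp3 hD₂ hDp c₁ c₂ c₃ c₄
      (hne p (reduceMod_ne_zero_of_map hp hp' hg hg2.not_isUnit)) hnu (hne 2 hg2.ne_zero)
      (fun h => hg2.not_isUnit ?_) hg hgΔ
    exact (isUnit_pow_iff two_ne_zero).1 ((hass 2).isUnit h)

end CyclicSymmetry
end VirtualKnots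

noncomputable section
namespace VirtualKnots

/-! ### Colourings of Gauss codes -/
section Colourings

/-- The coefficient `t ^ (-ε)`. -/
def twist (ε : ℤˣ) : ℤ[T;T⁻¹] := LaurentPolynomial.T (-(ε : ℤ))

theorem twist_mul_twist_neg (ε : ℤˣ) : twist ε * twist (-ε) = 1 := by
  rw [twist, twist, ← LaurentPolynomial.T_add]
  simp

variable {A B : Type*} [AddCommGroup A] [Module ℤ[T;T⁻¹] A] [AddCommGroup B] [Module ℤ[T;T⁻¹] B]

/-- The colour of the arc leaving a letter, in terms of the colour `x` of the arc entering it and of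
the colours `y` of the over-strands. -/
def stepColour (y : ℕ → A) (x : A) (l : GaussLetter) : A :=
  if l.2.1 then x else twist l.2.2 • x + (1 - twist l.2.2) • y l.1

/-- The colour of the last arc of a word. -/
def runColour (y : ℕ → A) (x : A) (w : List GaussLetter) : A := w.foldl (stepColour y) x

/-- The elements which vanish if every crossing is passed over in its colour. -/
def overRelations (y : ℕ → A) : A → List GaussLetter → List A
  | _, [] => []
  | x, l :: w => (if l.2.1 then [y l.1 - x] else []) ++ overRelations y (stepColour y x l) w

/-- Every crossing `c` of the word is passed over in the colour `y c`. -/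
def OverColoured (y : ℕ → A) (x : A) (w : List GaussLetter) : Prop :=
  ∀ r ∈ overRelations y x w, r = 0

/-- `x` and `y` are a colouring of the Gauss code `w`: `x` is the colour of the initial arc, `y c`
the colour of the over-strand of `c`, normalized to be `x` if `c` does not occur. -/
def IsColouring (w : List GaussLetter) (x : A) (y : ℕ → A) : Prop :=
  OverColoured y x w ∧ runColour y x w = x ∧ ∀ c ∉ crossings w, y c = x

@[simp] theorem runColour_nil (y : ℕ → A) (x : A) : runColour y x [] = x := rfl

@[simp] theorem runColour_over (y : ℕ → A) (x : A) (c : ℕ) (ε : ℤˣ) (w : List GaussLetter) :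
    runColour y x ((c, true, ε) :: w) = runColour y x w := rfl

@[simp] theorem runColour_under (y : ℕ → A) (x : A) (c : ℕ) (ε : ℤˣ) (w : List GaussLetter) :
    runColour y x ((c, false, ε) :: w) = runColour y (twist ε • x + (1 - twist ε) • y c) w := rfl

theorem runColour_append (y : ℕ → A) (x : A) (u v : List GaussLetter) :
    runColour y x (u ++ v) = runColour y (runColour y x u) v := List.foldl_append

@[simp] theorem overColoured_nil (y : ℕ → A) (x : A) : OverColoured y x [] := by
  simp [OverColoured, overRelations]

@[simp] theorem overColoured_over (y : ℕ → A) (x : A) (c : ℕ) (ε : ℤˣ) (w : List GaussLetter) :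
    OverColoured y x ((c, true, ε) :: w) ↔ y c = x ∧ OverColoured y x w := by
  simp [OverColoured, overRelations, stepColour, sub_eq_zero]

@[simp] theorem overColoured_under (y : ℕ → A) (x : A) (c : ℕ) (ε : ℤˣ) (w : List GaussLetter) :
    OverColoured y x ((c, false, ε) :: w)
      ↔ OverColoured y (twist ε • x + (1 - twist ε) • y c) w := by
  simp [OverColoured, overRelations, stepColour]

theorem overColoured_append (y : ℕ → A) (x : A) (u v : List GaussLetter) :
    OverColoured y x (u ++ v) ↔ OverColoured y x u ∧ OverColoured y (runColour y x u) v := by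
  induction u generalizing x with
  | nil => simp
  | cons l u ih => obtain ⟨c, b, ε⟩ := l; cases b <;> simp [ih, and_assoc]

theorem mem_crossings {w : List GaussLetter} {c : ℕ} : c ∈ crossings w ↔ ∃ l ∈ w, l.1 = c := by
  simp [crossings]

theorem crossings_append (u v : List GaussLetter) :
    crossings (u ++ v) = crossings u ∪ crossings v := by
  simp [crossings]

theorem crossings_cons (l : GaussLetter) (w : List GaussLetter) :
    crossings (l :: w) = insert l.1 (crossings w) := by
  simp [crossings]

@[simp] theorem crossings_nil : crossings [] = ∅ := rfl

theorem runColour_congr {y y' : ℕ → A} {w : List GaussLetter} (h : ∀ c ∈ crossings w, y c = y' c)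
    (x : A) : runColour y x w = runColour y' x w := by
  induction w generalizing x with
  | nil => rfl
  | cons l w ih =>
    obtain ⟨c, b, ε⟩ := l
    simp only [crossings_cons, Finset.mem_insert, forall_eq_or_imp] at h
    cases b <;> simp [ih h.2, h.1]

theorem overColoured_congr {y y' : ℕ → A} {w : List GaussLetter}
    (h : ∀ c ∈ crossings w, y c = y' c) (x : A) : OverColoured y x w ↔ OverColoured y' x w := by
  induction w generalizing x with
  | nil => simp
  | cons l w ih =>
    obtain ⟨c, b, ε⟩ := l
    simp only [crossings_cons, Finset.mem_insert, forall_eq_or_imp] at h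
    cases b <;> simp [ih h.2, h.1]

theorem map_runColour (f : A →ₗ[ℤ[T;T⁻¹]] B) (y : ℕ → A) (x : A) (w : List GaussLetter) :
    f (runColour y x w) = runColour (fun c => f (y c)) (f x) w := by
  induction w generalizing x with
  | nil => rfl
  | cons l w ih => obtain ⟨c, b, ε⟩ := l; cases b <;> simp [ih]

theorem map_overRelations (f : A →ₗ[ℤ[T;T⁻¹]] B) (y : ℕ → A) (x : A) (w : List GaussLetter) :
    (overRelations y x w).map f = overRelations (fun c => f (y c)) (f x) w := by
  induction w generalizing x with
  | nil => rfl
  | cons l w ih => obtain ⟨c, b, ε⟩ := l; cases b <;> simp [overRelations, ih, stepColour]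

/-- The free module on the colour of the initial arc and the colours of the over-strands. -/
abbrev ColourGenerators : Type := Option ℕ →₀ ℤ[T;T⁻¹]

/-- The tautological colour of the initial arc. -/
def initialGenerator : ColourGenerators := Finsupp.single none 1

/-- The tautological colour of the over-strand of a crossing. -/
def overGenerator (c : ℕ) : ColourGenerators := Finsupp.single (some c) 1

/-- The relations which hold in a colouring of the Gauss code `w`. -/
def colourRelations (w : List GaussLetter) : Submodule ℤ[T;T⁻¹] ColourGenerators :=
  Submodule.span _ ({r | r ∈ overRelations overGenerator initialGenerator w} ∪
    ({runColour overGenerator initialGenerator w - initialGenerator} ∪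
      {r | ∃ c ∉ crossings w, r = overGenerator c - initialGenerator}))

/-- The module in which the Gauss code `w` has its universal colouring. -/
abbrev ColourModule (w : List GaussLetter) : Type := ColourGenerators ⧸ colourRelations w

/-- This is the universal property of `ColourModule`: it represents the functor of colourings, so
moves need only be studied on colourings with values in an arbitrary module. -/
theorem isColouring_map_iff (f : ColourGenerators →ₗ[ℤ[T;T⁻¹]] A) (w : List GaussLetter) :
    IsColouring w (f initialGenerator) (fun c => f (overGenerator c))
      ↔ colourRelations w ≤ LinearMap.ker f := by
  rw [colourRelations, Submodule.span_le, Set.union_subset_iff, Set.union_subset_iff, IsColouring,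
    OverColoured, ← map_overRelations, ← map_runColour]
  simp only [List.mem_map, forall_exists_index, and_imp, forall_apply_eq_imp_iff₂,
    Set.singleton_subset_iff, SetLike.mem_coe, LinearMap.mem_ker, map_sub, sub_eq_zero]
  refine and_congr Iff.rfl (and_congr Iff.rfl ?_)
  constructor
  · rintro h _ ⟨c, hc, rfl⟩
    simpa [sub_eq_zero] using h c hc
  · intro h c hc
    simpa [sub_eq_zero] using h ⟨c, hc, rfl⟩

theorem isColouring_universal (w : List GaussLetter) :
    IsColouring w ((colourRelations w).mkQ initialGenerator)
      (fun c => (colourRelations w).mkQ (overGenerator c)) := by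
  rw [isColouring_map_iff, Submodule.ker_mkQ]

theorem IsColouring.exists_lift {w : List GaussLetter} {x : A} {y : ℕ → A}
    (h : IsColouring w x y) : ∃ f : ColourModule w →ₗ[ℤ[T;T⁻¹]] A,
      f ((colourRelations w).mkQ initialGenerator) = x ∧
      ∀ c, f ((colourRelations w).mkQ (overGenerator c)) = y c := by
  let g : ColourGenerators →ₗ[ℤ[T;T⁻¹]] A :=
    Finsupp.lift A ℤ[T;T⁻¹] (Option ℕ) fun o => o.elim x y
  have hx : g initialGenerator = x := by simp [g, initialGenerator]
  have hy : ∀ c, g (overGenerator c) = y c := by simp [g, overGenerator]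
  have hg : colourRelations w ≤ LinearMap.ker g := by
    rw [← isColouring_map_iff, hx]
    simpa only [hy] using h
  exact ⟨(colourRelations w).liftQ g hg, hx, hy⟩

theorem ColourModule.hom_ext {w : List GaussLetter} {f g : ColourModule w →ₗ[ℤ[T;T⁻¹]] A}
    (hx : f ((colourRelations w).mkQ initialGenerator)
      = g ((colourRelations w).mkQ initialGenerator))
    (hy : ∀ c, f ((colourRelations w).mkQ (overGenerator c))
      = g ((colourRelations w).mkQ (overGenerator c))) : f = g := by
  apply Submodule.linearMap_qext
  ext o
  cases o with
  | none => exact hx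
  | some c => exact hy c

/-- A natural bijection between the colourings of two Gauss codes is induced by an isomorphism of
their colour modules. -/
theorem ColourModule.nonempty_equiv {w w' : List GaussLetter}
    (X X' : ∀ {A : Type} [AddCommGroup A] [Module ℤ[T;T⁻¹] A], A → (ℕ → A) → A)
    (Y Y' : ∀ {A : Type} [AddCommGroup A] [Module ℤ[T;T⁻¹] A], A → (ℕ → A) → ℕ → A)
    (natX : ∀ {A B : Type} [AddCommGroup A] [Module ℤ[T;T⁻¹] A] [AddCommGroup B]
      [Module ℤ[T;T⁻¹] B] (f : A →ₗ[ℤ[T;T⁻¹]] B) x y, f (X x y) = X (f x) (fun c => f (y c)))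
    (natX' : ∀ {A B : Type} [AddCommGroup A] [Module ℤ[T;T⁻¹] A] [AddCommGroup B]
      [Module ℤ[T;T⁻¹] B] (f : A →ₗ[ℤ[T;T⁻¹]] B) x y, f (X' x y) = X' (f x) (fun c => f (y c)))
    (natY : ∀ {A B : Type} [AddCommGroup A] [Module ℤ[T;T⁻¹] A] [AddCommGroup B]
      [Module ℤ[T;T⁻¹] B] (f : A →ₗ[ℤ[T;T⁻¹]] B) x y c, f (Y x y c) = Y (f x) (fun c => f (y c)) c)
    (natY' : ∀ {A B : Type} [AddCommGroup A] [Module ℤ[T;T⁻¹] A] [AddCommGroup B]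
      [Module ℤ[T;T⁻¹] B] (f : A →ₗ[ℤ[T;T⁻¹]] B) x y c,
        f (Y' x y c) = Y' (f x) (fun c => f (y c)) c)
    (hX : ∀ {A : Type} [AddCommGroup A] [Module ℤ[T;T⁻¹] A] (x : A) y, IsColouring w x y →
      IsColouring w' (X x y) (Y x y) ∧ X' (X x y) (Y x y) = x ∧ ∀ c, Y' (X x y) (Y x y) c = y c)
    (hX' : ∀ {A : Type} [AddCommGroup A] [Module ℤ[T;T⁻¹] A] (x : A) y, IsColouring w' x y →
      IsColouring w (X' x y) (Y' x y) ∧ X (X' x y) (Y' x y) = x ∧ ∀ c, Y (X' x y) (Y' x y) c = y c) :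
    Nonempty (ColourModule w ≃ₗ[ℤ[T;T⁻¹]] ColourModule w') := by
  -- The Yoneda argument: the transformed universal colourings induce maps in both directions, and
  -- naturality shows that they are inverse on generators.
  obtain ⟨h₁, h₂, h₃⟩ := hX _ _ (isColouring_universal w)
  obtain ⟨h₁', h₂', h₃'⟩ := hX' _ _ (isColouring_universal w')
  obtain ⟨f, hf₁, hf₂⟩ := h₁.exists_lift
  obtain ⟨g, hg₁, hg₂⟩ := h₁'.exists_lift
  refine ⟨LinearEquiv.ofLinearMap g f ?_ ?_⟩
  · apply ColourModule.hom_ext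
    · simp only [LinearMap.comp_apply, hf₁, LinearMap.id_apply]
      rw [natX, hg₁]
      simpa only [hg₂] using h₂'
    · intro c
      simp only [LinearMap.comp_apply, hf₂, LinearMap.id_apply]
      rw [natY, hg₁]
      simpa only [hg₂] using h₃' c
  · apply ColourModule.hom_ext
    · simp only [LinearMap.comp_apply, hg₁, LinearMap.id_apply]
      rw [natX', hf₁]
      simpa only [hf₂] using h₂
    · intro c
      simp only [LinearMap.comp_apply, hg₂, LinearMap.id_apply]
      rw [natY', hf₁]
      simpa only [hf₂] using h₃ c

theorem ColourModule.nonempty_equiv_of_iff {w w' : List GaussLetter}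
    (h : ∀ {A : Type} [AddCommGroup A] [Module ℤ[T;T⁻¹] A] (x : A) y,
      IsColouring w x y ↔ IsColouring w' x y) :
    Nonempty (ColourModule w ≃ₗ[ℤ[T;T⁻¹]] ColourModule w') :=
  ColourModule.nonempty_equiv (fun x _ => x) (fun x _ => x) (fun _ y => y) (fun _ y => y)
    (fun _ _ _ => rfl) (fun _ _ _ => rfl) (fun _ _ _ _ => rfl) (fun _ _ _ _ => rfl)
    (fun x y hxy => ⟨(h x y).1 hxy, rfl, fun _ => rfl⟩)
    (fun x y hxy => ⟨(h x y).2 hxy, rfl, fun _ => rfl⟩)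

end Colourings
end VirtualKnots
end

noncomputable section
namespace VirtualKnots

/-! ### Colourings under change of base point, relabelling and the first two Reidemeister moves. -/

section MoveInvariance

/-- A crossing of a Gauss code occurs in no other letters than its own two. -/
theorem IsGaussCode.notMem_crossings {w r : List GaussLetter} (hw : IsGaussCode w) {c : ℕ} {ε : ℤˣ}
    (h : w.Perm (O c ε :: U c ε :: r)) : c ∉ crossings r := by
  obtain ⟨h₁, h₂, h₃⟩ := hw
  have hn := h.nodup_iff.1 h₁
  rw [mem_crossings]
  rintro ⟨⟨c', b, ε'⟩, hl, rfl⟩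
  have hε : ε' = ε := h₃ c' b true ε' ε (h.mem_iff.2 (by simp [hl])) (h.mem_iff.2 (by simp))
  subst hε
  cases b <;> simp_all

variable {A : Type*} [AddCommGroup A] [Module ℤ[T;T⁻¹] A]

theorem twist_smul_add_smul_self (ε : ℤˣ) (x : A) : twist ε • x + (1 - twist ε) • x = x := by
  rw [← add_smul]; simp

/-- The kink opens the word, so its over-strand has the initial colour `x`, which is also the
normalized value for absent labels; passing under one's own colour changes nothing. -/
theorem isColouring_r1_over {c : ℕ} {ε : ℤˣ} {w : List GaussLetter} (hc : c ∉ crossings w) (x : A)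
    (y : ℕ → A) : IsColouring w x y ↔ IsColouring ([O c ε, U c ε] ++ w) x y := by
  simp only [IsColouring, List.cons_append, List.nil_append, overColoured_over,
    overColoured_under, runColour_over, runColour_under, crossings_cons]
  constructor
  · rintro ⟨h₁, h₂, h₃⟩
    rw [h₃ c hc, twist_smul_add_smul_self]
    exact ⟨⟨rfl, h₁⟩, h₂, fun d hd => h₃ d (by simp_all)⟩
  · rintro ⟨⟨h₁, h₂⟩, h₃, h₄⟩
    rw [h₁, twist_smul_add_smul_self] at h₂ h₃
    refine ⟨h₂, h₃, fun d hd => ?_⟩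
    by_cases hdc : d = c
    · rw [hdc, h₁]
    · exact h₄ d (by simp_all)

theorem isColouring_r1_under {c : ℕ} {ε : ℤˣ} {w : List GaussLetter} (hc : c ∉ crossings w) (x : A)
    (y : ℕ → A) : IsColouring w x y ↔ IsColouring ([U c ε, O c ε] ++ w) x y := by
  simp only [IsColouring, List.cons_append, List.nil_append, overColoured_over,
    overColoured_under, runColour_over, runColour_under, crossings_cons]
  constructor
  · rintro ⟨h₁, h₂, h₃⟩
    rw [h₃ c hc, twist_smul_add_smul_self]
    exact ⟨⟨rfl, h₁⟩, h₂, fun d hd => h₃ d (by simp_all)⟩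
  · rintro ⟨⟨h₁, h₂⟩, h₃, h₄⟩
    have h : y c = x := by
      -- Here the over-strand is the arc leaving the under-passage, so its colour satisfies an
      -- equation that determines it because `twist ε` is invertible.
      have h₅ : twist ε • y c = twist ε • x := by
        linear_combination (norm := module) h₁
      have h₆ := congrArg (fun z => twist (-ε) • z) h₅
      simpa only [smul_smul, mul_comm (twist (-ε)), twist_mul_twist_neg, one_smul] using h₆
    rw [h, twist_smul_add_smul_self] at h₂ h₃
    refine ⟨h₂, h₃, fun d hd => ?_⟩
    by_cases hdc : d = c
    · rw [hdc, h]
    · exact h₄ d (by simp_all)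

theorem twist_smul_twist_neg (ε : ℤˣ) (x z : A) :
    twist (-ε) • (twist ε • x + (1 - twist ε) • z) + (1 - twist (-ε)) • z = x := by
  linear_combination (norm := module) twist_mul_twist_neg ε • (x - z)

theorem twist_neg_smul_twist (ε : ℤˣ) (x z : A) :
    twist ε • (twist (-ε) • x + (1 - twist (-ε)) • z) + (1 - twist ε) • z = x := by
  linear_combination (norm := module) twist_mul_twist_neg ε • (x - z)

/-- Both new crossings are passed over in the initial colour, which agrees with the normalization,
and the two under-passages have opposite signs and cancel. -/
theorem isColouring_r2_direct {c d : ℕ} {ε : ℤˣ} {u v : List GaussLetter}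
    (hc : c ∉ crossings (u ++ v)) (hd : d ∉ crossings (u ++ v)) (x : A) (y : ℕ → A) :
    IsColouring (u ++ v) x y
      ↔ IsColouring ([O c ε, O d (-ε)] ++ u ++ [U c ε, U d (-ε)] ++ v) x y := by
  have key : y c = x → y d = x →
      (IsColouring (u ++ v) x y
      ↔ IsColouring ([O c ε, O d (-ε)] ++ u ++ [U c ε, U d (-ε)] ++ v) x y) := by
    intro h h'
    simp only [IsColouring, overColoured_append, runColour_append, overColoured_over,
      overColoured_under, runColour_over, runColour_under, runColour_nil, overColoured_nil, h, h',
      crossings_append, crossings_cons, twist_smul_twist_neg, true_and, and_true, and_assoc]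
    refine and_congr Iff.rfl (and_congr Iff.rfl (and_congr Iff.rfl (forall_congr' fun e => ?_)))
    by_cases hec : e = c
    · simp [hec, h]
    by_cases hed : e = d
    · simp [hed, h']
    simp [hec, hed]
  constructor
  · intro h
    exact (key (h.2.2 c hc) (h.2.2 d hd)).1 h
  · intro h
    have h' := h.1
    simp only [List.cons_append, overColoured_over] at h'
    exact (key h'.1 h'.2.1).2 h

theorem isColouring_r2_opposite {c d : ℕ} {ε : ℤˣ} {u v : List GaussLetter}
    (hc : c ∉ crossings (u ++ v)) (hd : d ∉ crossings (u ++ v)) (x : A) (y : ℕ → A) :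
    IsColouring (u ++ v) x y
      ↔ IsColouring ([O c ε, O d (-ε)] ++ u ++ [U d (-ε), U c ε] ++ v) x y := by
  have key : y c = x → y d = x →
      (IsColouring (u ++ v) x y
      ↔ IsColouring ([O c ε, O d (-ε)] ++ u ++ [U d (-ε), U c ε] ++ v) x y) := by
    intro h h'
    simp only [IsColouring, overColoured_append, runColour_append, overColoured_over,
      overColoured_under, runColour_over, runColour_under, runColour_nil, overColoured_nil, h, h',
      crossings_append, crossings_cons, twist_neg_smul_twist, true_and, and_true, and_assoc]
    refine and_congr Iff.rfl (and_congr Iff.rfl (and_congr Iff.rfl (forall_congr' fun e => ?_)))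
    by_cases hec : e = c
    · simp [hec, h]
    by_cases hed : e = d
    · simp [hed, h']
    simp [hec, hed]
  constructor
  · intro h
    exact (key (h.2.2 c hc) (h.2.2 d hd)).1 h
  · intro h
    have h' := h.1
    simp only [List.cons_append, overColoured_over] at h'
    exact (key h'.1 h'.2.1).2 h

/-- The initial colour becomes the colour reached after `u`; absent labels must be renormalized to
it, hence the case distinction. -/
theorem isColouring_rotate {u v : List GaussLetter} {x : A} {y : ℕ → A}
    (h : IsColouring (u ++ v) x y) : IsColouring (v ++ u) (runColour y x u)
      (fun c => if c ∈ crossings (u ++ v) then y c else runColour y x u) := by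
  obtain ⟨h₁, h₂, h₃⟩ := h
  have hu : ∀ c ∈ crossings u,
      (if c ∈ crossings (u ++ v) then y c else runColour y x u) = y c := by
    intro c hc; simp [crossings_append, hc]
  have hv : ∀ c ∈ crossings v,
      (if c ∈ crossings (u ++ v) then y c else runColour y x u) = y c := by
    intro c hc; simp [crossings_append, hc]
  rw [overColoured_append] at h₁
  rw [runColour_append] at h₂
  refine ⟨?_, ?_, ?_⟩
  · rw [overColoured_append, overColoured_congr hu, overColoured_congr hv, runColour_congr hv, h₂]
    exact h₁.symm
  · rw [runColour_append, runColour_congr hu, runColour_congr hv, h₂]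
  · intro c hc
    refine if_neg ?_
    simpa [crossings_append, and_comm] using hc

theorem colourModule_rotate (u v : List GaussLetter) :
    Nonempty (ColourModule (u ++ v) ≃ₗ[ℤ[T;T⁻¹]] ColourModule (v ++ u)) := by
  have inv : ∀ {A : Type} [AddCommGroup A] [Module ℤ[T;T⁻¹] A] (u v) (x : A) (y : ℕ → A),
      IsColouring (u ++ v) x y → runColour (fun c => if c ∈ crossings (u ++ v) then y c else
        runColour y x u) (runColour y x u) v = x ∧ ∀ c, (if c ∈ crossings (v ++ u) then
          (if c ∈ crossings (u ++ v) then y c else runColour y x u) else runColour (fun c => if c ∈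
            crossings (u ++ v) then y c else runColour y x u) (runColour y x u) v) = y c := by
    intro A _ _ u v x y h
    have hx : runColour (fun c => if c ∈ crossings (u ++ v) then y c else
        runColour y x u) (runColour y x u) v = x := by
      rw [runColour_congr (y' := y) (fun c hc => by simp [crossings_append, hc]), ← runColour_append,
        h.2.1]
    refine ⟨hx, fun c => ?_⟩
    rw [hx]
    by_cases hc : c ∈ crossings (u ++ v)
    · rw [if_pos hc, if_pos (by simpa [crossings_append, or_comm] using hc)]
    · rw [if_neg (by simpa [crossings_append, and_comm] using hc), h.2.2 c hc]
  refine ColourModule.nonempty_equiv (fun x y => runColour y x u) (fun x y => runColour y x v)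
    (fun x y c => if c ∈ crossings (u ++ v) then y c else runColour y x u)
    (fun x y c => if c ∈ crossings (v ++ u) then y c else runColour y x v)
    (fun f x y => map_runColour f y x u) (fun f x y => map_runColour f y x v) ?_ ?_ ?_ ?_
  · intro A B _ _ _ _ f x y c
    rw [apply_ite f, map_runColour]
  · intro A B _ _ _ _ f x y c
    rw [apply_ite f, map_runColour]
  · exact fun x y h => ⟨isColouring_rotate h, inv u v x y h⟩
  · exact fun x y h => ⟨isColouring_rotate h, inv v u x y h⟩

theorem isColouring_relabel (f : Equiv.Perm ℕ) {w : List GaussLetter} (x : A) (y : ℕ → A) :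
    IsColouring (w.map fun l => (f l.1, l.2)) x y ↔ IsColouring w x (fun c => y (f c)) := by
  have h₁ : ∀ x, runColour y x (w.map fun l => (f l.1, l.2)) = runColour (fun c => y (f c)) x w := by
    induction w with
    | nil => simp
    | cons l w ih => obtain ⟨c, b, ε⟩ := l; intro x; cases b <;> simp [ih]
  have h₂ : ∀ x, OverColoured y x (w.map fun l => (f l.1, l.2))
      ↔ OverColoured (fun c => y (f c)) x w := by
    clear h₁
    induction w with
    | nil => simp
    | cons l w ih => obtain ⟨c, b, ε⟩ := l; intro x; cases b <;> simp [ih]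
  rw [IsColouring, h₁, h₂, IsColouring]
  refine and_congr Iff.rfl (and_congr Iff.rfl ?_)
  have hm : ∀ c, f c ∈ crossings (w.map fun l => (f l.1, l.2)) ↔ c ∈ crossings w := by
    intro c; simp [mem_crossings]
  constructor
  · intro h c hc
    exact h (f c) (by rwa [hm])
  · intro h c hc
    obtain ⟨c, rfl⟩ := f.surjective c
    exact h c (by rwa [← hm])

theorem colourModule_relabel (f : Equiv.Perm ℕ) (w : List GaussLetter) :
    Nonempty (ColourModule w ≃ₗ[ℤ[T;T⁻¹]] ColourModule (w.map fun l => (f l.1, l.2))) := by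
  refine ColourModule.nonempty_equiv (fun x _ => x) (fun x _ => x)
    (fun _ y c => y (f.symm c)) (fun _ y c => y (f c)) (fun _ _ _ => rfl) (fun _ _ _ => rfl)
    (fun _ _ _ _ => rfl) (fun _ _ _ _ => rfl) ?_ ?_
  · intro A _ _ x y h
    refine ⟨?_, rfl, fun c => by simp⟩
    rw [isColouring_relabel]
    simpa using h
  · intro A _ _ x y h
    exact ⟨(isColouring_relabel f x y).1 h, rfl, fun c => by simp⟩

end MoveInvariance
end VirtualKnots
end

noncomputable section
namespace VirtualKnots

/-! ### Colourings under the third Reidemeister move. -/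

section ThirdMove

theorem ordered_perm (s : ℤˣ) (l m : GaussLetter) : (ordered s l m).Perm [l, m] := by
  unfold ordered
  split_ifs
  · rfl
  · exact List.Perm.swap _ _ _

theorem crossings_ordered (s : ℤˣ) (l m : GaussLetter) :
    crossings (ordered s l m) = {l.1, m.1} := by
  ext c
  simp [mem_crossings, (ordered_perm s l m).mem_iff, eq_comm]

variable {A : Type*} [AddCommGroup A] [Module ℤ[T;T⁻¹] A]

/-- Colouring the word `v` by `z` has the same effect as colouring the word `u` by `y`. -/
def ColouringTransfer (y z : ℕ → A) (u v : List GaussLetter) : Prop :=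
  ∀ x, OverColoured y x u → OverColoured z x v ∧ runColour z x v = runColour y x u

theorem ColouringTransfer.append {y z : ℕ → A} {u v u' v' : List GaussLetter}
    (h : ColouringTransfer y z u v) (h' : ColouringTransfer y z u' v') :
    ColouringTransfer y z (u ++ u') (v ++ v') := by
  intro x hx
  rw [overColoured_append] at hx
  obtain ⟨h₁, h₂⟩ := h x hx.1
  obtain ⟨h₃, h₄⟩ := h' _ hx.2
  rw [overColoured_append, runColour_append, runColour_append, h₂]
  exact ⟨⟨h₁, h₃⟩, h₄⟩

theorem ColouringTransfer.of_congr {y z : ℕ → A} {u : List GaussLetter}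
    (h : ∀ c ∈ crossings u, y c = z c) : ColouringTransfer y z u u := fun x hx =>
  ⟨(overColoured_congr h x).1 hx, (runColour_congr h x).symm⟩

theorem colouringTransfer_over_over {y z : ℕ → A} {a b : ℕ} (ha : z a = y a) (hb : z b = y b)
    (s s' εa εb : ℤˣ) :
    ColouringTransfer y z (ordered s (O a εa) (O b εb)) (ordered s' (O a εa) (O b εb)) := by
  intro x
  unfold ordered
  split_ifs <;> simp +contextual [ha, hb]

/-- The colour of the crossing of the two lower strands after a third move. -/
def thirdMoveColour (κ : ℤˣ) (a c : ℕ) (y : ℕ → A) : ℕ → A :=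
  Function.update y c (twist (-κ) • y c + (1 - twist (-κ)) • y a)

/-- The middle strand passes over `c` before going under the top strand on one side of the move and
after it on the other, so the colour at `c` changes by the action of the top colour. The exponent of
that action depends on `κ` alone, not on `εa`. -/
theorem colouringTransfer_under_over {y : ℕ → A} {a c : ℕ} (hac : a ≠ c) (κ εa εc : ℤˣ) :
    ColouringTransfer y (thirdMoveColour κ a c y)
      (ordered (κ * εa) (U a εa) (O c εc)) (ordered (-κ * εa) (U a εa) (O c εc)) := by
  intro x
  have h := twist_mul_twist_neg 1
  rcases Int.units_eq_one_or κ with rfl | rfl <;> rcases Int.units_eq_one_or εa with rfl | rfl <;>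
    simp [ordered, thirdMoveColour, hac, units_ne_neg_self, neg_eq_iff_eq_neg] <;> intro h' <;> rw [h']
  all_goals first
    | rfl
    | linear_combination (norm := module) h • (x - y a)

/-- Self-distributivity of the Alexander quandle: acting by the middle colour and then by the top
one equals acting by the top colour and then by the transformed middle one. The hypothesis `hab`
says that `a` and `b` lie on one top strand. -/
theorem colouringTransfer_under_under {y : ℕ → A} {a b c : ℕ} (hbc : b ≠ c) (hab : y a = y b)
    (κ εb εc : ℤˣ) :
    ColouringTransfer y (thirdMoveColour κ a c y)
      (ordered (κ * εb) (U b εb) (U c εc)) (ordered (-κ * εb) (U b εb) (U c εc)) := by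
  intro x
  have h := twist_mul_twist_neg 1
  rcases Int.units_eq_one_or κ with rfl | rfl <;> rcases Int.units_eq_one_or εb with rfl | rfl <;>
    simp [ordered, thirdMoveColour, hbc, hab, units_ne_neg_self, neg_eq_iff_eq_neg]
  all_goals first
    | module
    | linear_combination (norm := module) h • (y b - y c)
    | linear_combination (norm := module) (1 - twist εc) • h • (y b - y c)
    | linear_combination (norm := module) (1 - twist εc) • h • (y c - y b)

theorem ColouringTransfer.isColouring {w w' : List GaussLetter} {x : A} {y : ℕ → A} {κ : ℤˣ}
    {a c : ℕ} (h : ColouringTransfer y (thirdMoveColour κ a c y) w w')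
    (hw : crossings w' = crossings w) (hc : c ∈ crossings w) (hx : IsColouring w x y) :
    IsColouring w' x (thirdMoveColour κ a c y) := by
  obtain ⟨h₁, h₂⟩ := h x hx.1
  refine ⟨h₁, h₂.trans hx.2.1, fun d hd => ?_⟩
  rw [hw] at hd
  have hdc : d ≠ c := by rintro rfl; exact hd hc
  rw [thirdMoveColour, Function.update_of_ne hdc, hx.2.2 d hd]

theorem thirdMoveColour_neg {κ : ℤˣ} {a c : ℕ} (hac : a ≠ c) (y : ℕ → A) (d : ℕ) :
    thirdMoveColour (-κ) a c (thirdMoveColour κ a c y) d = y d := by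
  by_cases hd : d = c
  · subst hd
    simp only [thirdMoveColour, Function.update_self, Function.update_of_ne hac]
    exact twist_smul_twist_neg _ _ _
  · simp [thirdMoveColour, hd]

/-- One side of a third move, the strands being passed in the order top, middle, bottom. -/
def thirdMoveWordTMB (κ : ℤˣ) (a b c : ℕ) (εa εb εc : ℤˣ) (u v w : List GaussLetter) :
    List GaussLetter :=
  ordered (κ * (εa * εb * εc)) (O a εa) (O b εb) ++ u ++
    ordered (κ * εa) (U a εa) (O c εc) ++ v ++ ordered (κ * εb) (U b εb) (U c εc) ++ w

/-- One side of a third move, the strands being passed in the order top, bottom, middle. -/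
def thirdMoveWordTBM (κ : ℤˣ) (a b c : ℕ) (εa εb εc : ℤˣ) (u v w : List GaussLetter) :
    List GaussLetter :=
  ordered (κ * (εa * εb * εc)) (O a εa) (O b εb) ++ u ++
    ordered (κ * εb) (U b εb) (U c εc) ++ v ++ ordered (κ * εa) (U a εa) (O c εc) ++ w

theorem eq_of_overColoured_ordered {y : ℕ → A} {x : A} {s εa εb : ℤˣ} {a b : ℕ}
    (h : OverColoured y x (ordered s (O a εa) (O b εb))) : y a = y b := by
  unfold ordered at h
  split_ifs at h <;> simp at h
  · rw [h.1, h.2]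
  · rw [h.1, h.2]

theorem isColouring_thirdMoveWordTMB {κ εa εb εc : ℤˣ} {a b c : ℕ} {u v w : List GaussLetter}
    (hc : c ∉ insert a (insert b (crossings u ∪ crossings v ∪ crossings w))) {x : A} {y : ℕ → A}
    (h : IsColouring (thirdMoveWordTMB κ a b c εa εb εc u v w) x y) :
    IsColouring (thirdMoveWordTMB (-κ) a b c εa εb εc u v w) x (thirdMoveColour κ a c y) := by
  simp only [Finset.mem_insert, Finset.mem_union, not_or] at hc
  obtain ⟨hca, hcb, ⟨hcu, hcv⟩, hcw⟩ := hc
  have ht : ∀ {r : List GaussLetter}, c ∉ crossings r →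
      ColouringTransfer y (thirdMoveColour κ a c y) r r := fun hr =>
    ColouringTransfer.of_congr fun d hd => by
      rw [thirdMoveColour, Function.update_of_ne (by rintro rfl; exact hr hd)]
  have hab : y a = y b := by
    have h₁ := h.1
    simp only [thirdMoveWordTMB, overColoured_append] at h₁
    exact eq_of_overColoured_ordered h₁.1.1.1.1.1
  have htop : ∀ s s', ColouringTransfer y (thirdMoveColour κ a c y)
      (ordered s (O a εa) (O b εb)) (ordered s' (O a εa) (O b εb)) := fun s s' =>
    colouringTransfer_over_over (by simp [thirdMoveColour, Ne.symm hca])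
      (by simp [thirdMoveColour, Ne.symm hcb]) _ _ _ _
  refine ColouringTransfer.isColouring ?_ ?_ ?_ h
  · exact (((((htop _ _).append (ht hcu)).append
      (colouringTransfer_under_over (Ne.symm hca) _ _ _)).append (ht hcv)).append
      (colouringTransfer_under_under (Ne.symm hcb) hab _ _ _)).append (ht hcw)
  · simp [thirdMoveWordTMB, crossings_append, crossings_ordered]
  · simp [thirdMoveWordTMB, crossings_append, crossings_ordered]

theorem isColouring_thirdMoveWordTBM {κ εa εb εc : ℤˣ} {a b c : ℕ} {u v w : List GaussLetter}
    (hc : c ∉ insert a (insert b (crossings u ∪ crossings v ∪ crossings w))) {x : A} {y : ℕ → A}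
    (h : IsColouring (thirdMoveWordTBM κ a b c εa εb εc u v w) x y) :
    IsColouring (thirdMoveWordTBM (-κ) a b c εa εb εc u v w) x (thirdMoveColour κ a c y) := by
  simp only [Finset.mem_insert, Finset.mem_union, not_or] at hc
  obtain ⟨hca, hcb, ⟨hcu, hcv⟩, hcw⟩ := hc
  have ht : ∀ {r : List GaussLetter}, c ∉ crossings r →
      ColouringTransfer y (thirdMoveColour κ a c y) r r := fun hr =>
    ColouringTransfer.of_congr fun d hd => by
      rw [thirdMoveColour, Function.update_of_ne (by rintro rfl; exact hr hd)]
  have hab : y a = y b := by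
    have h₁ := h.1
    simp only [thirdMoveWordTBM, overColoured_append] at h₁
    exact eq_of_overColoured_ordered h₁.1.1.1.1.1
  have htop : ∀ s s', ColouringTransfer y (thirdMoveColour κ a c y)
      (ordered s (O a εa) (O b εb)) (ordered s' (O a εa) (O b εb)) := fun s s' =>
    colouringTransfer_over_over (by simp [thirdMoveColour, Ne.symm hca])
      (by simp [thirdMoveColour, Ne.symm hcb]) _ _ _ _
  refine ColouringTransfer.isColouring ?_ ?_ ?_ h
  · exact (((((htop _ _).append (ht hcu)).append
      (colouringTransfer_under_under (Ne.symm hcb) hab _ _ _)).append (ht hcv)).append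
      (colouringTransfer_under_over (Ne.symm hca) _ _ _)).append (ht hcw)
  · simp [thirdMoveWordTBM, crossings_append, crossings_ordered]
  · simp [thirdMoveWordTBM, crossings_append, crossings_ordered]

theorem nonempty_equiv_of_thirdMoveColour {κ : ℤˣ} {a c : ℕ} (hac : a ≠ c)
    {w w' : List GaussLetter}
    (h : ∀ {A : Type} [AddCommGroup A] [Module ℤ[T;T⁻¹] A] {x : A} {y : ℕ → A},
      IsColouring w x y → IsColouring w' x (thirdMoveColour κ a c y))
    (h' : ∀ {A : Type} [AddCommGroup A] [Module ℤ[T;T⁻¹] A] {x : A} {y : ℕ → A},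
      IsColouring w' x y → IsColouring w x (thirdMoveColour (-κ) a c y)) :
    Nonempty (ColourModule w ≃ₗ[ℤ[T;T⁻¹]] ColourModule w') := by
  have nat : ∀ (κ : ℤˣ) {A B : Type} [AddCommGroup A] [Module ℤ[T;T⁻¹] A] [AddCommGroup B]
      [Module ℤ[T;T⁻¹] B] (f : A →ₗ[ℤ[T;T⁻¹]] B) (y : ℕ → A) (d : ℕ),
      f (thirdMoveColour κ a c y d) = thirdMoveColour κ a c (fun d => f (y d)) d := by
    intro κ A B _ _ _ _ f y d
    by_cases hd : d = c
    · subst hd; simp [thirdMoveColour]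
    · simp [thirdMoveColour, hd]
  refine ColourModule.nonempty_equiv (fun x _ => x) (fun x _ => x)
    (fun _ y => thirdMoveColour κ a c y) (fun _ y => thirdMoveColour (-κ) a c y)
    (fun _ _ _ => rfl) (fun _ _ _ => rfl) (fun f _ y d => nat κ f y d)
    (fun f _ y d => nat (-κ) f y d) ?_ ?_
  · exact fun x y hx => ⟨h hx, rfl, thirdMoveColour_neg hac y⟩
  · intro A _ _ x y hx
    refine ⟨h' hx, rfl, fun d => ?_⟩
    have := thirdMoveColour_neg (κ := -κ) hac y d
    rwa [neg_neg] at this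

/-- The colour module is an invariant of virtual knots. -/
theorem Move.colourModule {w w' : List GaussLetter} (h : Move w w') (hw : IsGaussCode w)
    (hw' : IsGaussCode w') : Nonempty (ColourModule w ≃ₗ[ℤ[T;T⁻¹]] ColourModule w') := by
  cases h with
  | rotate u v => exact colourModule_rotate u v
  | relabel f w => exact colourModule_relabel f w
  | r1_over c ε w =>
    exact ColourModule.nonempty_equiv_of_iff
      (isColouring_r1_over (hw'.notMem_crossings (List.Perm.refl _)))
  | r1_under c ε w =>
    exact ColourModule.nonempty_equiv_of_iff
      (isColouring_r1_under (hw'.notMem_crossings (List.Perm.swap _ _ _)))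
  | r2_direct c d ε u v =>
    have hc : c ∉ crossings (O d (-ε) :: U d (-ε) :: (u ++ v)) :=
      hw'.notMem_crossings (ε := ε) (List.perm_iff_count.2 fun l => by
        simp only [List.count_append, List.count_cons, List.count_nil]; omega)
    have hd : d ∉ crossings (O c ε :: U c ε :: (u ++ v)) :=
      hw'.notMem_crossings (ε := -ε) (List.perm_iff_count.2 fun l => by
        simp only [List.count_append, List.count_cons, List.count_nil]; omega)
    simp only [crossings_cons, Finset.mem_insert, not_or] at hc hd
    exact ColourModule.nonempty_equiv_of_iff (isColouring_r2_direct hc.2.2 hd.2.2)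
  | r2_opposite c d ε u v =>
    have hc : c ∉ crossings (O d (-ε) :: U d (-ε) :: (u ++ v)) :=
      hw'.notMem_crossings (ε := ε) (List.perm_iff_count.2 fun l => by
        simp only [List.count_append, List.count_cons, List.count_nil]; omega)
    have hd : d ∉ crossings (O c ε :: U c ε :: (u ++ v)) :=
      hw'.notMem_crossings (ε := -ε) (List.perm_iff_count.2 fun l => by
        simp only [List.count_append, List.count_cons, List.count_nil]; omega)
    simp only [crossings_cons, Finset.mem_insert, not_or] at hc hd
    exact ColourModule.nonempty_equiv_of_iff (isColouring_r2_opposite hc.2.2 hd.2.2)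
  | r3_tmb κ a b c εa εb εc u v w =>
    -- The label `c` occurs only in its own two letters, so recolouring it affects nothing outside
    -- the triangle.
    have hc : c ∉ crossings (O a εa :: O b εb :: U a εa :: U b εb :: (u ++ v ++ w)) :=
      hw.notMem_crossings (ε := εc) (List.perm_iff_count.2 fun l => by
        simp only [List.count_append, (ordered_perm _ _ _).count_eq, List.count_cons,
          List.count_nil]; omega)
    have hc' : c ∉ insert a (insert b (crossings u ∪ crossings v ∪ crossings w)) := by
      simp only [crossings_cons, crossings_append] at hc
      simp_all
    have hac : a ≠ c := by rintro rfl; simp at hc'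
    refine nonempty_equiv_of_thirdMoveColour (κ := κ) hac
      (fun h => isColouring_thirdMoveWordTMB hc' h) (fun h => ?_)
    have := isColouring_thirdMoveWordTMB (κ := -κ) hc' h
    rwa [neg_neg] at this
  | r3_tbm κ a b c εa εb εc u v w =>
    have hc : c ∉ crossings (O a εa :: O b εb :: U a εa :: U b εb :: (u ++ v ++ w)) :=
      hw.notMem_crossings (ε := εc) (List.perm_iff_count.2 fun l => by
        simp only [List.count_append, (ordered_perm _ _ _).count_eq, List.count_cons,
          List.count_nil]; omega)
    have hc' : c ∉ insert a (insert b (crossings u ∪ crossings v ∪ crossings w)) := by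
      simp only [crossings_cons, crossings_append] at hc
      simp_all
    have hac : a ≠ c := by rintro rfl; simp at hc'
    refine nonempty_equiv_of_thirdMoveColour (κ := κ) hac
      (fun h => isColouring_thirdMoveWordTBM hc' h) (fun h => ?_)
    have := isColouring_thirdMoveWordTBM (κ := -κ) hc' h
    rwa [neg_neg] at this

end ThirdMove
end VirtualKnots
end

noncomputable section
namespace VirtualKnots

/-! ### The Jacobian presents the colour module; invariance of the first elementary ideal. -/

section WirtingerPresentation

theorem crossingSign_eq {w : List GaussLetter} (hw : IsGaussCode w) {c : ℕ} {b : Bool} {ε : ℤˣ}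
    (h : (c, b, ε) ∈ w) : crossingSign w c = ε := by
  unfold crossingSign
  split_ifs with h₁
  · exact hw.2.2 _ _ _ _ _ h₁ h
  · have hO : O c ε ∈ w := by
      cases b
      · exact hw.2.1 _ _ _ h
      · exact h
    rcases Int.units_eq_one_or ε with rfl | rfl
    · exact absurd hO h₁
    · rfl

theorem letter_mem_of_mem_crossings {w : List GaussLetter} (hw : IsGaussCode w) {c : ℕ}
    (hc : c ∈ crossings w) (b : Bool) : (c, b, crossingSign w c) ∈ w := by
  obtain ⟨⟨c, b', ε⟩, hl, rfl⟩ := mem_crossings.1 hc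
  rw [crossingSign_eq hw hl]
  by_cases hb : b = b'
  · rwa [hb]
  · have := hw.2.1 _ _ _ hl
    rwa [← Bool.eq_not_of_ne hb] at this

theorem nextUnder_mod (w : List GaussLetter) (k : ℕ) : nextUnder w (k % w.length) = nextUnder w k := by
  rw [nextUnder, List.rotate_mod, nextUnder]

theorem nextUnder_of_under {w : List GaussLetter} {k : ℕ} (hk : k < w.length) {c : ℕ} {ε : ℤˣ}
    (h : w[k] = U c ε) : nextUnder w k = c := by
  rw [nextUnder, List.rotate_eq_drop_append_take hk.le, List.drop_eq_getElem_cons hk, h]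
  simp

theorem nextUnder_of_over {w : List GaussLetter} {k : ℕ} (hk : k < w.length) {c : ℕ} {ε : ℤˣ}
    (h : w[k] = O c ε) : nextUnder w k = nextUnder w (k + 1) := by
  have e : w.rotate k = O c ε :: (w.drop (k + 1) ++ w.take k) := by
    rw [List.rotate_eq_drop_append_take hk.le, List.drop_eq_getElem_cons hk, h]
    rfl
  rw [nextUnder, nextUnder, ← List.rotate_rotate, e]
  simp [List.rotate_cons_succ]

theorem exists_under {w : List GaussLetter} (hw : IsGaussCode w) (h0 : w ≠ []) :
    ∃ (k : ℕ) (hk : k < w.length) (c : ℕ) (ε : ℤˣ), w[k] = U c ε := by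
  obtain ⟨⟨c, b, ε⟩, hl⟩ := List.exists_mem_of_ne_nil w h0
  have : U c ε ∈ w := by
    cases b
    · exact hl
    · exact hw.2.1 _ _ _ hl
  obtain ⟨k, hk, h⟩ := List.getElem_of_mem this
  exact ⟨k, hk, c, ε, h⟩

theorem nextUnder_mem {w : List GaussLetter} (hw : IsGaussCode w) (h0 : w ≠ []) (k : ℕ) :
    nextUnder w k ∈ crossings w := by
  obtain ⟨j, hj, c, ε, h⟩ := exists_under hw h0
  have hmem : U c ε ∈ w.rotate k := by
    rw [List.mem_rotate, ← h]
    exact List.getElem_mem hj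
  obtain ⟨l, hl⟩ : ∃ l, (w.rotate k).find? (fun x => !x.2.1) = some l := by
    rw [← Option.isSome_iff_exists, List.find?_isSome]
    exact ⟨_, hmem, rfl⟩
  rw [nextUnder, hl, mem_crossings]
  exact ⟨l, List.mem_rotate.1 (List.mem_of_find?_eq_some hl), rfl⟩

theorem outgoingArc_eq {w : List GaussLetter} (hw : IsGaussCode w) {k : ℕ} (hk : k < w.length)
    {c : ℕ} {ε : ℤˣ} (h : w[k] = U c ε) : outgoingArc w c = nextUnder w (k + 1) := by
  have hs := crossingSign_eq hw (h ▸ List.getElem_mem hk)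
  rw [outgoingArc, hs, ← h, List.Nodup.idxOf_getElem hw.1]

theorem overArc_eq {w : List GaussLetter} (hw : IsGaussCode w) {k : ℕ} (hk : k < w.length)
    {c : ℕ} {ε : ℤˣ} (h : w[k] = O c ε) : overArc w c = nextUnder w k := by
  have hs := crossingSign_eq hw (h ▸ List.getElem_mem hk)
  rw [overArc, hs, ← h, List.Nodup.idxOf_getElem hw.1]

variable {A B : Type*} [AddCommGroup A] [Module ℤ[T;T⁻¹] A] [AddCommGroup B] [Module ℤ[T;T⁻¹] B]

/-- The long arcs of `w` satisfy the linearized Wirtinger relations. -/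
def IsArcColouring (w : List GaussLetter) (z : ℕ → A) : Prop :=
  ∀ c ∈ crossings w, twist (crossingSign w c) • z c
    + (1 - twist (crossingSign w c)) • z (overArc w c) = z (outgoingArc w c)

/-- The colours of the over-strands, in terms of the colours of the long arcs. -/
def overColourOfArcs (w : List GaussLetter) (z : ℕ → A) (c : ℕ) : A :=
  if c ∈ crossings w then z (overArc w c) else z (nextUnder w 0)

/-- The colours of the long arcs, in terms of the colours of the initial arc and the over-strands. -/
def arcColour (w : List GaussLetter) (x : A) (y : ℕ → A) (c : ℕ) : A :=
  runColour y x (w.take (w.idxOf (U c (crossingSign w c))))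

theorem map_arcColour (f : A →ₗ[ℤ[T;T⁻¹]] B) (w : List GaussLetter) (x : A) (y : ℕ → A) (c : ℕ) :
    f (arcColour w x y c) = arcColour w (f x) (fun c => f (y c)) c := map_runColour _ _ _ _

theorem arcColour_eq {w : List GaussLetter} (hw : IsGaussCode w) {k : ℕ} (hk : k < w.length)
    {c : ℕ} {ε : ℤˣ} (h : w[k] = U c ε) (x : A) (y : ℕ → A) :
    arcColour w x y c = runColour y x (w.take k) := by
  have hs := crossingSign_eq hw (h ▸ List.getElem_mem hk)
  rw [arcColour, hs, ← h, List.Nodup.idxOf_getElem hw.1]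

/-- Along the code an over-letter stays on the same long arc, and an under-letter changes the colour
exactly by its Wirtinger relation. -/
theorem IsArcColouring.run {w : List GaussLetter} (hw : IsGaussCode w) {z : ℕ → A}
    (hz : IsArcColouring w z) (k : ℕ) (hk : k ≤ w.length) :
    OverColoured (overColourOfArcs w z) (z (nextUnder w 0)) (w.take k) ∧
    runColour (overColourOfArcs w z) (z (nextUnder w 0)) (w.take k) = z (nextUnder w k) := by
  induction k with
  | zero => simp
  | succ k ih =>
    have hk' : k < w.length := hk
    obtain ⟨h₁, h₂⟩ := ih hk'.le
    rw [← List.take_append_getElem hk', overColoured_append, runColour_append, h₂]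
    rcases hl : w[k] with ⟨c, b, ε⟩
    have hm : (c, b, ε) ∈ w := hl ▸ List.getElem_mem hk'
    have hc : c ∈ crossings w := mem_crossings.2 ⟨_, hm, rfl⟩
    cases b
    · have h := hz c hc
      rw [crossingSign_eq hw hm, outgoingArc_eq hw hk' hl] at h
      simp [h₁, nextUnder_of_under hk' hl, overColourOfArcs, hc, h]
    · simp [h₁, overColourOfArcs, hc, overArc_eq hw hk' hl, nextUnder_of_over hk' hl]

theorem IsArcColouring.isColouring {w : List GaussLetter} (hw : IsGaussCode w) {z : ℕ → A}
    (hz : IsArcColouring w z) : IsColouring w (z (nextUnder w 0)) (overColourOfArcs w z) := by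
  obtain ⟨h₁, h₂⟩ := hz.run hw w.length le_rfl
  rw [List.take_length] at h₁ h₂
  refine ⟨h₁, ?_, fun c hc => if_neg hc⟩
  rw [h₂, ← nextUnder_mod, Nat.mod_self]

theorem IsColouring.run {w : List GaussLetter} (hw : IsGaussCode w) {x : A} {y : ℕ → A}
    (h : IsColouring w x y) (k : ℕ) (hk : k ≤ w.length) :
    runColour y x (w.take k) = arcColour w x y (nextUnder w k) := by
  rcases eq_or_ne w [] with rfl | h0
  · simp [arcColour]
  -- A long arc is named after its end, so the claim propagates backwards, and at an under-letter it
  -- holds outright. The arc through the base point is handled by running from the first reading up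
  -- to an under-letter, then from the end of the word, where the colouring closes up.
  have down : ∀ j k, k + j ≤ w.length →
      runColour y x (w.take (k + j)) = arcColour w x y (nextUnder w (k + j)) →
      runColour y x (w.take k) = arcColour w x y (nextUnder w k) := by
    intro j
    induction j with
    | zero => exact fun k _ h => h
    | succ j ih =>
      intro k hk hj
      have hk' : k < w.length := by omega
      rcases hl : w[k] with ⟨c, b, ε⟩
      cases b
      · rw [nextUnder_of_under hk' hl, arcColour_eq hw hk' hl]
      · rw [nextUnder_of_over hk' hl, ← ih (k + 1) (by omega) (by convert! hj using 3 <;> omega),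
          ← List.take_append_getElem hk', runColour_append, hl]
        rfl
  obtain ⟨j, hj, c, ε, hl⟩ := exists_under hw h0
  have h₁ := down j 0 (by omega) (by
    rw [zero_add, nextUnder_of_under hj hl, arcColour_eq hw hj hl])
  refine down (w.length - k) k (by omega) ?_
  rw [Nat.add_sub_cancel' hk, List.take_length, h.2.1, ← nextUnder_mod, Nat.mod_self]
  simpa using h₁

theorem IsColouring.eq_arcColour_overArc {w : List GaussLetter} (hw : IsGaussCode w) {x : A}
    {y : ℕ → A} (h : IsColouring w x y) {c : ℕ} (hc : c ∈ crossings w) :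
    y c = arcColour w x y (overArc w c) := by
  obtain ⟨k, hk, hl⟩ := List.getElem_of_mem (letter_mem_of_mem_crossings hw hc true)
  rw [overArc_eq hw hk hl, ← h.run hw k hk.le]
  have h₁ := h.1
  rw [← List.take_append_drop k w, overColoured_append, List.drop_eq_getElem_cons hk, hl,
    overColoured_over] at h₁
  exact h₁.2.1

theorem IsColouring.isArcColouring {w : List GaussLetter} (hw : IsGaussCode w) {x : A} {y : ℕ → A}
    (h : IsColouring w x y) : IsArcColouring w (arcColour w x y) := by
  intro c hc
  obtain ⟨k, hk, hl⟩ := List.getElem_of_mem (letter_mem_of_mem_crossings hw hc false)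
  rw [← h.eq_arcColour_overArc hw hc, outgoingArc_eq hw hk hl, ← h.run hw (k + 1) hk,
    ← List.take_append_getElem hk, runColour_append, hl, arcColour_eq hw hk hl]
  rfl

theorem jacobian_sum_smul {w : List GaussLetter} (hw : IsGaussCode w) (c : crossings w) (z : ℕ → A) :
    ∑ d, jacobian w c d • z d = twist (crossingSign w c) • z c
      + (1 - twist (crossingSign w c)) • z (overArc w c) - z (outgoingArc w c) := by
  have h0 : w ≠ [] := by
    rintro rfl
    simpa using c.2
  have key : ∀ (e : ℕ), e ∈ crossings w → ∀ r : ℤ[T;T⁻¹],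
      ∑ d : crossings w, (if d.1 = e then r else 0) • z d = r • z e := by
    intro e he r
    rw [Finset.sum_eq_single ⟨e, he⟩]
    · simp
    · intro d _ hd
      rw [if_neg (fun h => hd (Subtype.ext h)), zero_smul]
    · simp
  simp only [jacobian, Matrix.of_apply, add_smul, sub_smul, Finset.sum_add_distrib,
    Finset.sum_sub_distrib]
  rw [key _ c.2, key (outgoingArc w c) (nextUnder_mem hw h0 _),
    key (overArc w c) (nextUnder_mem hw h0 _), one_smul]
  simp only [twist, sub_smul, one_smul, overArc, outgoingArc]
  abel

theorem jacobian_row_sum {w : List GaussLetter} (hw : IsGaussCode w) (c : crossings w) :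
    ∑ d, jacobian w c d = 0 := by
  have := jacobian_sum_smul hw c (fun _ => (1 : ℤ[T;T⁻¹]))
  simpa using this

/-- The Jacobian matrix presents the colour module. -/
theorem exists_isPresentation_jacobian {w : List GaussLetter} (hw : IsGaussCode w) (h0 : w ≠ []) :
    ∃ π : (crossings w → ℤ[T;T⁻¹]) →ₗ[ℤ[T;T⁻¹]] ColourModule w,
      IsPresentation (jacobian w) π := by
  set x := (colourRelations w).mkQ initialGenerator with hx
  set y := fun c => (colourRelations w).mkQ (overGenerator c) with hy
  have hu : IsColouring w x y := isColouring_universal w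
  let π := Fintype.linearCombination ℤ[T;T⁻¹] (fun c : crossings w => arcColour w x y c)
  let N := Submodule.span ℤ[T;T⁻¹] (Set.range fun c => jacobian w c)
  have hπ : N ≤ LinearMap.ker π := by
    rw [Submodule.span_le]
    rintro _ ⟨c, rfl⟩
    rw [SetLike.mem_coe, LinearMap.mem_ker, Fintype.linearCombination_apply, jacobian_sum_smul hw,
      sub_eq_zero]
    exact hu.isArcColouring hw c c.2
  -- The tautological arc colouring with values in the cokernel of the Jacobian. The map `f` it
  -- induces on the colour module is inverse to the one induced by `π`, which gives surjectivity and
  -- the kernel. The value 0 at absent labels is irrelevant.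
  let z : ℕ → (crossings w → ℤ[T;T⁻¹]) ⧸ N := fun c =>
    if h : c ∈ crossings w then N.mkQ (Pi.single ⟨c, h⟩ 1) else 0
  have hz : ∀ c : crossings w, z c = N.mkQ (Pi.single c 1) := fun c => by simp [z]
  have hzc : IsArcColouring w z := by
    intro c hc
    rw [← sub_eq_zero, ← jacobian_sum_smul hw ⟨c, hc⟩]
    have h₁ : jacobian w ⟨c, hc⟩ ∈ N := Submodule.subset_span ⟨_, rfl⟩
    rw [← Submodule.Quotient.mk_eq_zero, ← Submodule.mkQ_apply,
      pi_eq_sum_univ' (jacobian w ⟨c, hc⟩), map_sum] at h₁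
    rw [← h₁]
    refine Finset.sum_congr rfl fun d _ => ?_
    rw [map_smul, hz]
  obtain ⟨f, hfx, hfy⟩ := (hzc.isColouring hw).exists_lift
  have hfπ : ∀ v, f (π v) = N.mkQ v := by
    intro v
    rw [Fintype.linearCombination_apply, map_sum]
    conv_rhs => rw [pi_eq_sum_univ' v, map_sum]
    refine Finset.sum_congr rfl fun c _ => ?_
    rw [map_smul, map_smul, map_arcColour, ← hz]
    congr 1
    obtain ⟨k, hk, hl⟩ := List.getElem_of_mem (letter_mem_of_mem_crossings hw c.2 false)
    simp only [hx, hy, hfx, hfy]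
    rw [arcColour_eq hw hk hl, (hzc.run hw k hk.le).2, nextUnder_of_under hk hl]
  have hπz : ∀ c ∈ crossings w, N.liftQ π hπ (z c) = arcColour w x y c := by
    intro c hc
    rw [hz ⟨c, hc⟩]
    simp [π]
  have hπf : (N.liftQ π hπ) ∘ₗ f = LinearMap.id := by
    apply ColourModule.hom_ext
    · rw [LinearMap.comp_apply, hfx, hπz _ (nextUnder_mem hw h0 _), ← hu.run hw 0 (Nat.zero_le _)]
      rfl
    · intro c
      rw [LinearMap.comp_apply, hfy, LinearMap.id_apply]
      unfold overColourOfArcs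
      split_ifs with hc
      · rw [hπz (overArc w c) (nextUnder_mem hw h0 _)]
        exact (hu.eq_arcColour_overArc hw hc).symm
      · rw [hπz _ (nextUnder_mem hw h0 _), ← hu.run hw 0 (Nat.zero_le _)]
        exact (hu.2.2 c hc).symm
  refine ⟨π, ?_, ?_⟩
  · intro m
    obtain ⟨v, hv⟩ := N.mkQ_surjective (f m)
    refine ⟨v, ?_⟩
    have := LinearMap.congr_fun hπf m
    rw [LinearMap.comp_apply, ← hv] at this
    simpa using this
  · refine le_antisymm (fun v hv => ?_) hπ
    have h := hfπ v
    rw [LinearMap.mem_ker.1 hv, map_zero] at h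
    exact (Submodule.Quotient.mk_eq_zero N).1 h.symm

theorem firstElementaryIdeal_eq_adjIdeal {w : List GaussLetter} (h0 : w ≠ []) :
    firstElementaryIdeal w = adjIdeal (jacobian w) := by
  obtain ⟨l, hl⟩ := List.exists_mem_of_ne_nil w h0
  have hpos : 0 < (crossings w).card := Finset.card_pos.2 ⟨l.1, mem_crossings.2 ⟨l, hl, rfl⟩⟩
  exact span_minors_eq_adjIdeal (n := (crossings w).card - 1) (by simp; omega) _

/-- Truncated subtraction gives minors of size 0, and the empty determinant is 1. -/
theorem firstElementaryIdeal_nil : firstElementaryIdeal [] = ⊤ := by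
  rw [Ideal.eq_top_iff_one]
  have : IsEmpty (Fin ((crossings []).card - 1)) := Fin.isEmpty
  exact Ideal.subset_span ⟨isEmptyElim, isEmptyElim, Matrix.det_isEmpty.symm⟩

theorem exists_isPresentation_nil :
    ∃ π : (Unit → ℤ[T;T⁻¹]) →ₗ[ℤ[T;T⁻¹]] ColourModule [],
      IsPresentation (0 : Matrix Unit Unit ℤ[T;T⁻¹]) π := by
  set x := (colourRelations []).mkQ initialGenerator with hx
  let π := Fintype.linearCombination ℤ[T;T⁻¹] (fun _ : Unit => x)
  have h : IsColouring [] (Pi.single () 1 : Unit → ℤ[T;T⁻¹]) (fun _ => Pi.single () 1) := by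
    simp [IsColouring]
  obtain ⟨f, hfx, hfy⟩ := h.exists_lift
  have hfπ : ∀ v, f (π v) = v := by
    intro v
    ext
    simp [π, Fintype.linearCombination_apply, hx, -Submodule.mkQ_apply, hfx]
  have hπf : π ∘ₗ f = LinearMap.id := by
    apply ColourModule.hom_ext
    · rw [LinearMap.comp_apply, hfx]; simp [π, hx]
    · intro c
      rw [LinearMap.comp_apply, hfy, LinearMap.id_apply]
      refine Eq.trans ?_ ((isColouring_universal []).2.2 c (by simp)).symm
      simp [π, hx]
  refine ⟨π, fun m => ⟨f m, LinearMap.congr_fun hπf m⟩, ?_⟩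
  have e : Set.range (fun i => (0 : Matrix Unit Unit ℤ[T;T⁻¹]) i) = {0} :=
    Set.range_const (c := (0 : Unit → ℤ[T;T⁻¹]))
  rw [e, Submodule.span_zero_singleton, LinearMap.ker_eq_bot]
  exact Function.LeftInverse.injective hfπ

/-- Comparing adjugate ideals requires nonempty index types. The empty code has a free colour module
of rank one, so the 1 × 1 zero matrix, with adjugate 1, takes the place of its empty Jacobian. -/
theorem exists_presentation {w : List GaussLetter} (hw : IsGaussCode w) :
    ∃ (κ : Type) (_ : Fintype κ) (_ : DecidableEq κ) (_ : Nonempty κ) (S : Matrix κ κ ℤ[T;T⁻¹])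
      (π : (κ → ℤ[T;T⁻¹]) →ₗ[ℤ[T;T⁻¹]] ColourModule w),
      IsPresentation S π ∧ firstElementaryIdeal w = adjIdeal S := by
  rcases eq_or_ne w [] with rfl | h0
  · obtain ⟨π, hπ⟩ := exists_isPresentation_nil
    refine ⟨Unit, inferInstance, inferInstance, inferInstance, 0, π, hπ, ?_⟩
    rw [firstElementaryIdeal_nil, eq_comm, Ideal.eq_top_iff_one]
    have := adjugate_mem_adjIdeal (0 : Matrix Unit Unit ℤ[T;T⁻¹]) () ()
    rwa [Matrix.adjugate_subsingleton, Matrix.one_apply_eq] at this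
  · obtain ⟨π, hπ⟩ := exists_isPresentation_jacobian hw h0
    exact ⟨crossings w, inferInstance, inferInstance,
      ⟨⟨nextUnder w 0, nextUnder_mem hw h0 0⟩⟩, jacobian w, π, hπ,
      firstElementaryIdeal_eq_adjIdeal h0⟩

theorem firstElementaryIdeal_eq_of_equiv {w w' : List GaussLetter} (hw : IsGaussCode w)
    (hw' : IsGaussCode w') (e : ColourModule w ≃ₗ[ℤ[T;T⁻¹]] ColourModule w') :
    firstElementaryIdeal w = firstElementaryIdeal w' := by
  obtain ⟨κ, _, _, _, S, π, hπ, hS⟩ := exists_presentation hw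
  obtain ⟨κ', _, _, _, S', π', hπ', hS'⟩ := exists_presentation hw'
  rw [hS, hS']
  exact (hπ.comp_equiv e).adjIdeal_eq hπ'

/-- The first elementary ideal is an invariant of virtual knots. -/
theorem firstElementaryIdeal_eq {D E : GaussCode} (h : D.toVirtualKnot = E.toVirtualKnot) :
    firstElementaryIdeal D.1 = firstElementaryIdeal E.1 := by
  have h' := Quot.eqvGen_exact h
  clear h
  induction h' with
  | rel D E h =>
    obtain ⟨e⟩ := Move.colourModule h D.2 E.2
    exact firstElementaryIdeal_eq_of_equiv D.2 E.2 e
  | refl => rfl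
  | symm _ _ _ ih => exact ih.symm
  | trans _ _ _ _ _ ih₁ ih₂ => exact ih₁.trans ih₂

end WirtingerPresentation
end VirtualKnots
end

noncomputable section
namespace VirtualKnots

/-! ### A cyclic symmetry of a Gauss code permutes the crossings freely and fixes the Jacobian. -/

section CodeSymmetry

/-- Reading the code `w` from its `a`-th letter is the same as relabelling the crossings by `f`. -/
def IsCodeSymmetry (w : List GaussLetter) (a : ℕ) (f : ℕ → ℕ) : Prop :=
  w.rotate a = w.map fun l => (f l.1, l.2)

variable {w : List GaussLetter} {a : ℕ} {f : ℕ → ℕ}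

theorem IsCodeSymmetry.getElem (h : IsCodeSymmetry w a f) {k : ℕ} (hk : k < w.length) :
    w[(k + a) % w.length]'(Nat.mod_lt _ (by omega)) = (f w[k].1, w[k].2) := by
  have h₁ : (w.rotate a)[k]'(by simpa using hk) = (w.map fun l => (f l.1, l.2))[k]'(by simpa using hk) := by
    congr 1
  rw [List.getElem_rotate, List.getElem_map] at h₁
  exact h₁

theorem IsCodeSymmetry.mem (h : IsCodeSymmetry w a f) {l : GaussLetter} (hl : l ∈ w) :
    (f l.1, l.2) ∈ w := by
  rw [← List.mem_rotate (n := a), h]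
  exact List.mem_map.2 ⟨l, hl, rfl⟩

theorem IsCodeSymmetry.mem_crossings (h : IsCodeSymmetry w a f) {c : ℕ} (hc : c ∈ crossings w) :
    f c ∈ crossings w := by
  obtain ⟨l, hl, rfl⟩ := VirtualKnots.mem_crossings.1 hc
  exact VirtualKnots.mem_crossings.2 ⟨_, h.mem hl, rfl⟩

theorem IsCodeSymmetry.crossingSign (h : IsCodeSymmetry w a f) (hw : IsGaussCode w) {c : ℕ}
    (hc : c ∈ crossings w) : crossingSign w (f c) = crossingSign w c :=
  crossingSign_eq hw (h.mem (letter_mem_of_mem_crossings hw hc true))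

theorem IsCodeSymmetry.injOn (h : IsCodeSymmetry w a f) (hw : IsGaussCode w) {c d : ℕ}
    (hc : c ∈ crossings w) (hd : d ∈ crossings w) (hcd : f c = f d) : c = d := by
  have hn : (w.map fun l : GaussLetter => (f l.1, l.2)).Nodup := by
    rw [← h]
    exact List.nodup_rotate.2 hw.1
  have hs : VirtualKnots.crossingSign w c = VirtualKnots.crossingSign w d := by
    rw [← h.crossingSign hw hc, hcd, h.crossingSign hw hd]
  have := List.inj_on_of_nodup_map hn (letter_mem_of_mem_crossings hw hc true)
    (letter_mem_of_mem_crossings hw hd true) (by rw [hcd, hs])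
  exact congrArg Prod.fst this

theorem IsCodeSymmetry.nextUnder (h : IsCodeSymmetry w a f) (hw : IsGaussCode w) (h0 : w ≠ [])
    (k : ℕ) : nextUnder w (k + a) = f (nextUnder w k) := by
  have e : w.rotate (k + a) = (w.rotate k).map fun l => (f l.1, l.2) := by
    rw [add_comm, ← List.rotate_rotate, h, List.map_rotate]
  obtain ⟨l, hl⟩ : ∃ l, (w.rotate k).find? (fun x => !x.2.1) = some l := by
    obtain ⟨j, hj, c, ε, h⟩ := exists_under hw h0
    rw [← Option.isSome_iff_exists, List.find?_isSome]
    refine ⟨U c ε, ?_, rfl⟩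
    rw [List.mem_rotate, ← h]
    exact List.getElem_mem hj
  rw [VirtualKnots.nextUnder, VirtualKnots.nextUnder, e, List.find?_map]
  have : ((fun x : GaussLetter => !x.2.1) ∘ fun l : GaussLetter => (f l.1, l.2))
      = fun x : GaussLetter => !x.2.1 := rfl
  rw [this, hl]
  rfl

theorem IsCodeSymmetry.outgoingArc (h : IsCodeSymmetry w a f) (hw : IsGaussCode w) (h0 : w ≠ [])
    {c : ℕ} (hc : c ∈ crossings w) : outgoingArc w (f c) = f (outgoingArc w c) := by
  obtain ⟨k, hk, hl⟩ := List.getElem_of_mem (letter_mem_of_mem_crossings hw hc false)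
  have hl' := h.getElem hk
  simp only [hl] at hl'
  rw [outgoingArc_eq hw hk hl, outgoingArc_eq hw _ hl', ← h.nextUnder hw h0, ← nextUnder_mod,
    Nat.mod_add_mod, nextUnder_mod, add_right_comm]

theorem IsCodeSymmetry.overArc (h : IsCodeSymmetry w a f) (hw : IsGaussCode w) (h0 : w ≠ [])
    {c : ℕ} (hc : c ∈ crossings w) : overArc w (f c) = f (overArc w c) := by
  obtain ⟨k, hk, hl⟩ := List.getElem_of_mem (letter_mem_of_mem_crossings hw hc true)
  have hl' := h.getElem hk
  simp only [hl] at hl'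
  rw [overArc_eq hw hk hl, overArc_eq hw _ hl', nextUnder_mod, h.nextUnder hw h0]

theorem IsCodeSymmetry.exists_perm (h : IsCodeSymmetry w a f) (hw : IsGaussCode w) (h0 : w ≠ [])
    {q : ℕ} (hq : ∀ k, w.length ∣ k * a ↔ q ∣ k) :
    ∃ σ : Equiv.Perm (crossings w), (∀ x y, jacobian w (σ x) (σ y) = jacobian w x y) ∧
      ∀ (k : ℕ) (x : crossings w), (σ ^ k) x = x ↔ q ∣ k := by
  let F : crossings w → crossings w := fun c => ⟨f c, h.mem_crossings c.2⟩
  have hF : Function.Injective F := fun c d hcd =>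
    Subtype.ext (h.injOn hw c.2 d.2 (congrArg Subtype.val hcd))
  let σ : Equiv.Perm (crossings w) := Equiv.ofBijective F hF.bijective_of_finite
  have hσ : ∀ x, (σ x : ℕ) = f x := fun x => rfl
  refine ⟨σ, ?_, ?_⟩
  · have hiff : ∀ c ∈ crossings w, ∀ d ∈ crossings w, (f c = f d ↔ c = d) := fun c hc d hd =>
      ⟨h.injOn hw hc hd, congrArg f⟩
    intro x y
    simp only [jacobian, Matrix.of_apply, hσ, h.crossingSign hw x.2, h.outgoingArc hw h0 x.2,
      h.overArc hw h0 x.2, hiff y y.2 x x.2, hiff y y.2 (VirtualKnots.overArc w x) (nextUnder_mem hw h0 _),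
      hiff y y.2 (VirtualKnots.outgoingArc w x) (nextUnder_mem hw h0 _)]
  · intro k x
    obtain ⟨j, hj, hl⟩ := List.getElem_of_mem (letter_mem_of_mem_crossings hw x.2 true)
    -- Applying `σ` moves the over-letter of a crossing `a` places along the cyclic word. Letters do
    -- not repeat, so `σ ^ k` fixes a crossing exactly when the word length divides `k * a`.
    have key : ∀ k : ℕ, w[(j + k * a) % w.length]'(Nat.mod_lt _ (by omega))
        = O ((σ ^ k) x) (VirtualKnots.crossingSign w x) := by
      intro k
      induction k with
      | zero => simp [Nat.mod_eq_of_lt hj, hl]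
      | succ k ih =>
        have hlt : (j + k * a) % w.length < w.length := Nat.mod_lt _ (by omega)
        have := h.getElem hlt
        rw [ih] at this
        rw [pow_succ', Equiv.Perm.mul_apply, hσ]
        convert! this using 2
        rw [Nat.mod_add_mod]
        congr 1
        ring
    rw [← hq]
    constructor
    · intro hk
      have h₁ := (key k).trans (show _ = w[j] by rw [hk, hl])
      rw [hw.1.getElem_inj_iff] at h₁
      have h₂ : j + k * a ≡ j + 0 [MOD w.length] := by
        rw [Nat.ModEq, h₁, add_zero, Nat.mod_eq_of_lt hj]
      exact (Nat.modEq_zero_iff_dvd).1 (Nat.ModEq.add_left_cancel' j h₂)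
    · intro hk
      have h₁ := key k
      obtain ⟨m, hm⟩ := hk
      simp only [hm, Nat.add_mul_mod_self_left, Nat.mod_eq_of_lt hj, hl] at h₁
      exact Subtype.ext (congrArg Prod.fst h₁).symm

end CodeSymmetry
end VirtualKnots
end

noncomputable section
namespace VirtualKnots

/-! ### Lifting cyclic lists of parameters to the universal cover of the circle. -/

section PeriodicExtension

/-- The residue of an integer, as an index. -/
def cyclicIndex {N : ℕ} (hN : 0 < N) (k : ℤ) : Fin N :=
  ⟨(k % N).toNat, by
    have h₁ := Int.emod_lt_of_pos k (b := (N : ℤ)) (by omega)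
    have h₂ := Int.emod_nonneg k (b := (N : ℤ)) (by omega)
    omega⟩

/-- The extension of a family of parameters in `[0, 1)` to the universal cover of the circle. -/
def periodicExtension {N : ℕ} (hN : 0 < N) (s : Fin N → ℝ) (k : ℤ) : ℝ :=
  s (cyclicIndex hN k) + ((k / N : ℤ) : ℝ)

variable {N : ℕ}

theorem cyclicIndex_add_mul (hN : 0 < N) (k m : ℤ) : cyclicIndex hN (k + N * m) = cyclicIndex hN k := by
  simp [cyclicIndex]

theorem cyclicIndex_natCast (hN : 0 < N) (i : Fin N) : cyclicIndex hN (i : ℕ) = i := by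
  ext
  have : ((i : ℕ) : ℤ) % N = (i : ℕ) := Int.emod_eq_of_lt (by omega) (by omega)
  simp [cyclicIndex, this]

theorem periodicExtension_add_mul (hN : 0 < N) (s : Fin N → ℝ) (k m : ℤ) :
    periodicExtension hN s (k + N * m) = periodicExtension hN s k + m := by
  rw [periodicExtension, periodicExtension, cyclicIndex_add_mul,
    Int.add_mul_ediv_left _ _ (by omega)]
  push_cast
  ring

theorem periodicExtension_natCast (hN : 0 < N) (s : Fin N → ℝ) (i : Fin N) :
    periodicExtension hN s (i : ℕ) = s i := by
  have : ((i : ℕ) : ℤ) / N = 0 := Int.ediv_eq_zero_of_lt (by omega) (by omega)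
  rw [periodicExtension, cyclicIndex_natCast, this]
  simp

theorem periodicExtension_strictMono (hN : 0 < N) {s : Fin N → ℝ}
    (hs : StrictMono s) (hs' : ∀ i, s i ∈ Set.Ico (0 : ℝ) 1) : StrictMono (periodicExtension hN s) := by
  intro i j hij
  have hd : i / N ≤ j / N := Int.ediv_le_ediv (by omega) hij.le
  have hi := Int.emod_add_mul_ediv i N
  have hj := Int.emod_add_mul_ediv j N
  rcases hd.eq_or_lt with h | h
  · have : cyclicIndex hN i < cyclicIndex hN j := by
      rw [Fin.lt_def]
      have h₂ := Int.emod_nonneg i (b := (N : ℤ)) (by omega)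
      rw [h] at hi
      simp only [cyclicIndex]
      omega
    have := hs this
    rw [periodicExtension, periodicExtension, h]
    linarith
  · have h' : ((i / N : ℤ) : ℝ) + 1 ≤ ((j / N : ℤ) : ℝ) := by exact_mod_cast h
    have h₁ := (hs' (cyclicIndex hN i)).2
    have h₂ := (hs' (cyclicIndex hN j)).1
    rw [periodicExtension, periodicExtension]
    linarith

/-- A strictly increasing self-map of `ℤ` that commutes with a translation is a translation. -/
theorem exists_eq_add_of_strictMono (hN : 0 < N) {τ : ℤ → ℤ} (hτ : StrictMono τ)
    (hτN : ∀ k, τ (k + N) = τ k + N) : ∃ a, ∀ k, τ k = k + a := by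
  -- The displacement is monotone, as `τ` is strictly increasing on `ℤ`, and periodic; hence it is
  -- constant.
  have hm : Monotone fun k => τ k - k := monotone_int_of_le_succ fun k => by
    have := hτ (lt_add_one k)
    omega
  have hp : Function.Periodic (fun k => τ k - k) (N : ℤ) := fun k => by
    simp only [hτN]
    ring
  refine ⟨τ 0, fun k => ?_⟩
  have h₁ := hp.int_mul |k| k
  have h₂ := hp.int_mul |k| 0
  have hk : |k| ≤ |k| * N := le_mul_of_one_le_right (abs_nonneg k) (by omega)
  have h₃ := hm (show 0 ≤ k + |k| * N by linarith [neg_abs_le k])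
  have h₄ := hm (show k ≤ 0 + |k| * N by linarith [le_abs_self k])
  simp only [Int.cast_id] at h₁ h₂ h₃ h₄
  omega

end PeriodicExtension

section Cross

theorem cross_mul_mul (e z w : ℂ) : cross (e * z) (e * w) = Complex.normSq e * cross z w := by
  simp only [cross, Complex.normSq_apply, map_mul, Complex.mul_im, Complex.mul_re, Complex.conj_re,
    Complex.conj_im]
  ring

theorem cross_smul_smul (a b : ℝ) (z w : ℂ) : cross (a • z) (b • w) = a * b * cross z w := by
  simp only [cross, Complex.real_smul, map_mul, Complex.mul_im, Complex.mul_re, Complex.conj_re,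
    Complex.conj_im, Complex.ofReal_re, Complex.ofReal_im]
  ring

theorem cross_self (z : ℂ) : cross z z = 0 := by
  simp only [cross, Complex.mul_im, Complex.conj_re, Complex.conj_im]
  ring

end Cross

/-! ### From a rotation of a diagram to a symmetry of its Gauss code. -/

namespace VirtualKnotDiagram

variable {P : VirtualKnotDiagram}

theorem differentiable_curve (P : VirtualKnotDiagram) : Differentiable ℝ P.curve :=
  P.smooth.differentiable (by simp)

theorem deriv_curve_add_intCast (P : VirtualKnotDiagram) (s : ℝ) (m : ℤ) :
    deriv P.curve (s + m) = deriv P.curve s := by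
  have h : (fun x => P.curve (x + m)) = P.curve := by
    ext x
    have := (show Function.Periodic P.curve 1 from P.periodic).int_mul m x
    simpa using this
  rw [← deriv_comp_add_const, h]

theorem isOver_add_iff (P : VirtualKnotDiagram) (s t : ℝ) (m n : ℤ) :
    P.isOver (s + m) (t + n) ↔ P.isOver s t := by
  refine ⟨fun h => ?_, P.over_periodic s t m n⟩
  have := P.over_periodic _ _ (-m) (-n) h
  simpa using this

/-- The symmetry of a periodic diagram. -/
structure IsRotation (P : VirtualKnotDiagram) (e : ℂ) (h : ℝ → ℝ) : Prop where
  smooth : Differentiable ℝ h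
  deriv_pos : ∀ s, 0 < deriv h s
  add_one : ∀ s, h (s + 1) = h s + 1
  curve : ∀ s, P.curve (h s) = e * P.curve s
  isOver : ∀ s t, P.isOver (h s) (h t) ↔ P.isOver s t

variable {e : ℂ} {h : ℝ → ℝ}

theorem IsRotation.deriv_curve (H : P.IsRotation e h) (s : ℝ) :
    deriv h s • deriv P.curve (h s) = e * deriv P.curve s := by
  have h₁ : HasDerivAt (fun x => P.curve (h x)) (deriv h s • deriv P.curve (h s)) s :=
    (P.differentiable_curve (h s)).hasDerivAt.scomp s (H.smooth s).hasDerivAt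
  have h₂ : HasDerivAt (fun x => P.curve (h x)) (e * deriv P.curve s) s := by
    simp only [H.curve]
    exact (P.differentiable_curve s).hasDerivAt.const_mul e
  exact h₁.unique h₂

theorem IsRotation.iterate (H : P.IsRotation e h) (n : ℕ) : P.IsRotation (e ^ n) h^[n] := by
  induction n with
  | zero => exact ⟨differentiable_id, by simp, by simp, by simp, by simp⟩
  | succ n ih =>
    rw [Function.iterate_succ']
    refine ⟨H.smooth.comp ih.smooth, fun s => ?_, fun s => ?_, fun s => ?_, fun s t => ?_⟩
    · rw [deriv_comp _ (H.smooth _) (ih.smooth _)]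
      exact mul_pos (H.deriv_pos _) (ih.deriv_pos _)
    · simp only [Function.comp, ih.add_one, H.add_one]
    · simp only [Function.comp, ih.curve, H.curve, pow_succ']
      ring
    · simp only [Function.comp, H.isOver, ih.isOver]

/-- A reparametrization that does not move the curve is a deck transformation. -/
theorem IsRotation.samePoint_of_one (H : P.IsRotation 1 h) (s : ℝ) : SamePoint s (h s) := by
  by_contra hs
  refine P.transverse s (h s) (by rw [H.curve, one_mul]) hs ?_
  have h₁ := H.deriv_curve s
  rw [one_mul] at h₁
  -- The velocities at `s` and `h s` are parallel, so the two parameters cannot form a transverse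
  -- double point.
  have h₂ := cross_smul_smul (deriv h s) 1 (deriv P.curve (h s)) (deriv P.curve (h s))
  rwa [h₁, cross_self, mul_zero, one_smul] at h₂

/-- A rotation fixing a nonzero point of the plane is the identity, so missing the origin makes the
action free. Conversely, once `e ^ n = 1` the iterate moves no point of the curve, hence no point of
the circle. -/
theorem IsRotation.samePoint_iterate_iff (H : P.IsRotation e h) {q : ℕ} (he : IsPrimitiveRoot e q)
    (hP : ∀ s, P.curve s ≠ 0) (n : ℕ) (s : ℝ) : SamePoint s (h^[n] s) ↔ q ∣ n := by
  have Hn := H.iterate n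
  rw [← he.pow_eq_one_iff_dvd]
  constructor
  · rintro ⟨m, hm⟩
    have h₁ := Hn.curve s
    have h₂ := (show Function.Periodic P.curve 1 from P.periodic).int_mul m s
    rw [hm] at h₁
    rw [mul_one] at h₂
    rw [h₂] at h₁
    exact (mul_eq_right₀ (hP s)).1 h₁.symm
  · intro hn
    rw [hn] at Hn
    exact Hn.samePoint_of_one s

theorem IsRotation.cross_deriv_pos_iff (H : P.IsRotation e h) (he : e ≠ 0) (x s t : ℝ) :
    0 < x * cross (deriv P.curve (h s)) (deriv P.curve (h t)) ↔
      0 < x * cross (deriv P.curve s) (deriv P.curve t) := by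
  have h₁ := cross_smul_smul (deriv h s) (deriv h t) (deriv P.curve (h s)) (deriv P.curve (h t))
  rw [H.deriv_curve, H.deriv_curve, cross_mul_mul] at h₁
  have h₂ := mul_pos (H.deriv_pos s) (H.deriv_pos t)
  have h₃ := Complex.normSq_pos.2 he
  rw [← mul_pos_iff_of_pos_left h₂, mul_left_comm, ← h₁, mul_left_comm, mul_pos_iff_of_pos_left h₃]

theorem IsPeriodic.exists_isRotation {q : ℕ} (h : P.IsPeriodic q) :
    ∃ (e : ℂ) (h : ℝ → ℝ), P.IsRotation e h ∧ IsPrimitiveRoot e q := by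
  obtain ⟨hq, -, h, h₁, h₂, h₃, h₄, h₅⟩ := h
  exact ⟨_, h, ⟨h₁.differentiable (by simp), h₂, h₃, h₄, h₅⟩,
    Complex.isPrimitiveRoot_exp q (by omega)⟩

/-- The passages of the classical crossings along the universal cover of the circle. -/
structure IsLiftedCode (P : VirtualKnotDiagram) (N : ℕ) (S : ℤ → ℝ) (L : ℤ → GaussLetter) :
    Prop where
  strictMono : StrictMono S
  param_add_mul : ∀ k m, S (k + N * m) = S k + m
  letter_eq_iff : ∀ k l, L k = L l ↔ (N : ℤ) ∣ k - l
  isOver : ∀ i j c ε, L i = O c ε → L j = U c ε → P.isOver (S i) (S j)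
  sign : ∀ i j c ε, L i = O c ε → L j = U c ε →
    0 < ((ε : ℤ) : ℝ) * cross (deriv P.curve (S i)) (deriv P.curve (S j))
  exists_letters : ∀ a b, P.isOver a b →
    ∃ i j c ε, S i = a ∧ S j = b ∧ L i = O c ε ∧ L j = U c ε
  exists_partner : ∀ k, ∃ l, L l = ((L k).1, !(L k).2.1, (L k).2.2)
  sign_unique : ∀ k l, (L k).1 = (L l).1 → (L k).2.2 = (L l).2.2

theorem HasGaussCode.exists_isLiftedCode {w : List GaussLetter} (h : P.HasGaussCode w)
    (hw : IsGaussCode w) (hN : 0 < w.length) :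
    ∃ S, P.IsLiftedCode w.length S fun k => w.get (cyclicIndex hN k) := by
  obtain ⟨s, hs, hs', h₁, h₂⟩ := h
  have hL : ∀ l ∈ w, ∃ k : ℤ, w.get (cyclicIndex hN k) = l := fun l hl => by
    obtain ⟨n, hn⟩ := List.get_of_mem hl
    exact ⟨(n : ℕ), by rw [cyclicIndex_natCast, hn]⟩
  refine ⟨periodicExtension hN s, periodicExtension_strictMono hN hs hs',
    periodicExtension_add_mul hN s, fun k l => ?_, fun i j c ε hi hj => ?_,
    fun i j c ε hi hj => ?_, fun a b hab => ?_, fun k => ?_, fun k l hkl => ?_⟩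
  · rw [hw.1.get_inj_iff, ← Int.modEq_iff_dvd, cyclicIndex, cyclicIndex, Fin.mk.injEq]
    have h₁ := Int.emod_nonneg k (b := (w.length : ℤ)) (by omega)
    have h₂ := Int.emod_nonneg l (b := (w.length : ℤ)) (by omega)
    rw [Int.ModEq]
    omega
  · exact P.over_periodic _ _ _ _ (h₁ _ _ c ε hi hj).1
  · have := (h₁ _ _ c ε hi hj).2
    rwa [periodicExtension, periodicExtension, deriv_curve_add_intCast, deriv_curve_add_intCast]
  · have hf : ∀ x : ℝ, Int.fract x ∈ Set.Ico (0 : ℝ) 1 := fun x =>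
      ⟨Int.fract_nonneg x, Int.fract_lt_one x⟩
    have hab' : P.isOver (Int.fract a) (Int.fract b) := by
      rw [← Int.fract_add_floor a, ← Int.fract_add_floor b, isOver_add_iff] at hab
      exact hab
    obtain ⟨i, j, c, ε, hi, hj, hi', hj'⟩ := h₂ _ (hf a) _ (hf b) hab'
    refine ⟨(i : ℕ) + w.length * ⌊a⌋, (j : ℕ) + w.length * ⌊b⌋, c, ε, ?_, ?_, ?_, ?_⟩
    · rw [periodicExtension_add_mul, periodicExtension_natCast, hi, Int.fract_add_floor]
    · rw [periodicExtension_add_mul, periodicExtension_natCast, hj, Int.fract_add_floor]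
    · rw [cyclicIndex_add_mul, cyclicIndex_natCast, hi']
    · rw [cyclicIndex_add_mul, cyclicIndex_natCast, hj']
  · exact hL _ (hw.2.1 _ _ _ (List.get_mem w (cyclicIndex hN k)))
  · have hk := List.get_mem w (cyclicIndex hN k)
    have hl := List.get_mem w (cyclicIndex hN l)
    rcases hk' : w.get (cyclicIndex hN k) with ⟨c, b, ε⟩
    rcases hl' : w.get (cyclicIndex hN l) with ⟨d, b', δ⟩
    simp only [hk', hl'] at hk hl hkl ⊢
    subst hkl
    exact hw.2.2 _ _ _ _ _ hk hl

namespace IsLiftedCode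

variable {N : ℕ} {S : ℤ → ℝ} {L : ℤ → GaussLetter}

/-- The image of a classical crossing is again listed in the code, and its sign is the same because
a rotation and a reparametrization with positive derivative preserve orientation. -/
theorem exists_image (hL : P.IsLiftedCode N S L) (H : P.IsRotation e h) (he : e ≠ 0) {i j : ℤ}
    {c : ℕ} {ε : ℤˣ} (hi : L i = O c ε) (hj : L j = U c ε) :
    ∃ i' j' c', S i' = h (S i) ∧ S j' = h (S j) ∧ L i' = O c' ε ∧ L j' = U c' ε := by
  obtain ⟨i', j', c', ε', hSi, hSj, hi', hj'⟩ :=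
    hL.exists_letters _ _ ((H.isOver _ _).2 (hL.isOver i j c ε hi hj))
  have h₁ := hL.sign i j c ε hi hj
  have h₂ := hL.sign i' j' c' ε' hi' hj'
  rw [hSi, hSj, H.cross_deriv_pos_iff he] at h₂
  suffices ε' = ε by
    subst this
    exact ⟨i', j', c', hSi, hSj, hi', hj'⟩
  rcases Int.units_eq_one_or ε with rfl | rfl <;> rcases Int.units_eq_one_or ε' with rfl | rfl
  · rfl
  · simp only [Units.val_one, Units.val_neg, Int.cast_one, Int.cast_neg] at h₁ h₂
    linarith
  · simp only [Units.val_one, Units.val_neg, Int.cast_one, Int.cast_neg] at h₁ h₂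
    linarith
  · rfl

theorem exists_over_under (hL : P.IsLiftedCode N S L) (k : ℤ) :
    ∃ i j c ε, L i = O c ε ∧ L j = U c ε ∧ (k = i ∨ k = j) := by
  obtain ⟨l, hl⟩ := hL.exists_partner k
  rcases hk : L k with ⟨c, b, ε⟩
  rw [hk] at hl
  cases b
  · exact ⟨l, k, c, ε, hl, hk, Or.inr rfl⟩
  · exact ⟨k, l, c, ε, hk, hl, Or.inl rfl⟩

/-- On the universal cover `h` maps crossing parameters to crossing parameters, increasingly and
compatibly with the period, so it translates their indices. -/
theorem exists_shift (hL : P.IsLiftedCode N S L) (hN : 0 < N) (H : P.IsRotation e h) (he : e ≠ 0) :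
    ∃ a : ℤ, ∀ k, S (k + a) = h (S k) := by
  have : ∀ k, ∃ l, S l = h (S k) := fun k => by
    obtain ⟨i, j, c, ε, hi, hj, hk⟩ := hL.exists_over_under k
    obtain ⟨i', j', -, hi', hj', -⟩ := hL.exists_image H he hi hj
    rcases hk with rfl | rfl
    · exact ⟨i', hi'⟩
    · exact ⟨j', hj'⟩
  choose τ hτ using this
  have hh : StrictMono h := strictMono_of_deriv_pos H.deriv_pos
  have hS : ∀ k, S (k + N) = S k + 1 := fun k => by simpa using hL.param_add_mul k 1
  obtain ⟨a, ha⟩ := exists_eq_add_of_strictMono (τ := τ) hN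
    (fun k l hkl => hL.strictMono.lt_iff_lt.1 (by
      rw [hτ, hτ]
      exact hh (hL.strictMono hkl)))
    (fun k => hL.strictMono.injective (by rw [hτ, hS, hS, H.add_one, hτ]))
  exact ⟨a, fun k => by rw [← ha, hτ]⟩

variable {a : ℤ}

theorem letters_shift (hL : P.IsLiftedCode N S L) (H : P.IsRotation e h) (he : e ≠ 0)
    (ha : ∀ k, S (k + a) = h (S k)) {i j : ℤ} {c : ℕ} {ε : ℤˣ} (hi : L i = O c ε)
    (hj : L j = U c ε) : ∃ c', L (i + a) = O c' ε ∧ L (j + a) = U c' ε := by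
  obtain ⟨i', j', c', hSi, hSj, hi', hj'⟩ := hL.exists_image H he hi hj
  rw [← ha] at hSi hSj
  rw [hL.strictMono.injective hSi] at hi'
  rw [hL.strictMono.injective hSj] at hj'
  exact ⟨c', hi', hj'⟩

theorem letter_shift_snd (hL : P.IsLiftedCode N S L) (H : P.IsRotation e h) (he : e ≠ 0)
    (ha : ∀ k, S (k + a) = h (S k)) (k : ℤ) : (L (k + a)).2 = (L k).2 := by
  obtain ⟨i, j, c, ε, hi, hj, hk⟩ := hL.exists_over_under k
  obtain ⟨c', hi', hj'⟩ := hL.letters_shift H he ha hi hj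
  rcases hk with rfl | rfl
  · rw [hi, hi']
  · rw [hj, hj']

/-- This makes the relabelling of crossings well defined: a letter with a given label is, modulo
`N`, one of the two passages of that crossing, and those are shifted to passages of one crossing. -/
theorem letter_shift_fst (hL : P.IsLiftedCode N S L) (H : P.IsRotation e h) (he : e ≠ 0)
    (ha : ∀ k, S (k + a) = h (S k)) {k l : ℤ} (hkl : (L k).1 = (L l).1) :
    (L (k + a)).1 = (L (l + a)).1 := by
  have hs := hL.sign_unique k l hkl
  obtain ⟨i, j, c, ε, hi, hj, hk⟩ := hL.exists_over_under k
  obtain ⟨c', hi', hj'⟩ := hL.letters_shift H he ha hi hj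
  have hc : (L k).1 = c ∧ (L k).2.2 = ε ∧ (L (k + a)).1 = c' := by
    rcases hk with rfl | rfl
    · simp [hi, hi']
    · simp [hj, hj']
  have hadd : ∀ {m : ℤ}, L l = L m → L (l + a) = L (m + a) := fun {m} hm => by
    rw [hL.letter_eq_iff] at hm ⊢
    rwa [add_sub_add_right_eq_sub]
  rcases hl : L l with ⟨d, b, δ⟩
  rw [hl, hc.1] at hkl
  rw [hl, hc.2.1] at hs
  simp only at hkl hs
  subst hkl hs
  rw [hc.2.2]
  cases b
  · rw [hadd (hl.trans hj.symm), hj']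
  · rw [hadd (hl.trans hi.symm), hi']

theorem dvd_mul_iff (hL : P.IsLiftedCode N S L) (H : P.IsRotation e h) {q : ℕ}
    (he : IsPrimitiveRoot e q) (hP : ∀ s, P.curve s ≠ 0) (ha : ∀ k, S (k + a) = h (S k)) (n : ℕ) :
    (N : ℤ) ∣ n * a ↔ q ∣ n := by
  have hn : S (n * a) = h^[n] (S 0) := by
    induction n with
    | zero => simp
    | succ n ih => rw [Function.iterate_succ_apply', ← ih, ← ha, Nat.cast_succ, add_one_mul]
  rw [← H.samePoint_iterate_iff he hP n (S 0), ← hn]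
  have hS : ∀ m, S 0 + m = S (N * m) := fun m => by rw [← hL.param_add_mul, zero_add]
  simp only [SamePoint, hS, hL.strictMono.injective.eq_iff]
  rfl

end IsLiftedCode

/-- A rotational symmetry of a diagram is a cyclic symmetry of its Gauss code. -/
theorem IsPeriodic.exists_isCodeSymmetry {q : ℕ} (h : P.IsPeriodic q) {w : List GaussLetter}
    (hPw : P.HasGaussCode w) (hw : IsGaussCode w) (h0 : w ≠ []) :
    ∃ (a : ℕ) (f : ℕ → ℕ), IsCodeSymmetry w a f ∧ ∀ k, w.length ∣ k * a ↔ q ∣ k := by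
  have hN : 0 < w.length := List.length_pos_iff.2 h0
  have hP := h.2.1
  have hq := h.1
  obtain ⟨e, h, H, he⟩ := h.exists_isRotation
  have he0 : e ≠ 0 := he.ne_zero (by omega)
  obtain ⟨S, hL⟩ := hPw.exists_isLiftedCode hw hN
  obtain ⟨a, ha⟩ := hL.exists_shift hN H he0
  set L : ℤ → GaussLetter := fun k => w.get (cyclicIndex hN k) with hLdef
  have hf : Function.FactorsThrough (fun k => (L (k + a)).1) fun k => (L k).1 :=
    fun k l hkl => hL.letter_shift_fst H he0 ha hkl
  have hnn := Int.emod_nonneg a (b := (w.length : ℤ)) (by omega)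
  -- The shift `a` may be negative or large; only its residue modulo the length matters for rotating
  -- the word.
  have hcast : ((a % (w.length : ℤ)).toNat : ℤ) = a % w.length := Int.toNat_of_nonneg hnn
  refine ⟨(a % w.length).toNat,
    Function.extend (fun k => (L k).1) (fun k => (L (k + a)).1) fun _ => 0, ?_, fun k => ?_⟩
  · refine List.ext_getElem (by simp) fun n h₁ h₂ => ?_
    have h₃ : n < w.length := by simpa using h₂
    have h₄ : w[n] = L n := by
      have := cyclicIndex_natCast hN ⟨n, h₃⟩
      simp only at this
      simp only [hLdef, this, List.get_eq_getElem]
    have h₅ : w[(n + (a % w.length).toNat) % w.length]'(Nat.mod_lt _ hN) = L (n + a) := by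
      simp only [hLdef, List.get_eq_getElem, cyclicIndex]
      congr 1
      zify
      rw [hcast, Int.add_emod_emod, Int.toNat_of_nonneg]
      exact Int.emod_nonneg _ (by omega)
    rw [List.getElem_rotate, h₅, List.getElem_map, h₄, hf.extend_apply]
    exact Prod.ext rfl (hL.letter_shift_snd H he0 ha n)
  · rw [← hL.dvd_mul_iff H he hP ha, ← Int.natCast_dvd_natCast, Nat.cast_mul, hcast,
      Int.dvd_iff_emod_eq_zero, Int.mul_emod, Int.emod_emod, ← Int.mul_emod,
      ← Int.dvd_iff_emod_eq_zero]

end VirtualKnotDiagram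
end VirtualKnots
end

/-! ### Assembly. -/

namespace VirtualKnots

/-- An Alexander polynomial of `K` which does not become trivial modulo `p` excludes both
congruences modulo `2` if `K` has period `2p`. -/
theorem VirtualKnot.HasPeriod.not_congruences {K : VirtualKnot} {p : ℕ} (hp : p.Prime)
    (hp' : p ≠ 2) (hper : K.HasPeriod (2 * p)) {Δ : ℤ[T;T⁻¹]} (hΔ : K.IsAlexanderPolynomial Δ)
    (hnontrivial : ¬ DotEq (reduceMod p Δ) 1) :
    ¬ (Irreducible Δ ∧ ∃ g, Irreducible g ∧ DotEq (reduceMod 2 Δ) (g ^ 2)) ∧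
      ¬ ∃ g, Irreducible g ∧ Irreducible (reduceMod 2 g) ∧ DotEq Δ (g ^ 2) := by
  obtain ⟨P, hP, D, hPD, hD⟩ := hper
  obtain ⟨E, hE, h₁, h₂⟩ := hΔ
  rw [firstElementaryIdeal_eq (hE.trans hD.symm)] at h₁ h₂
  -- A periodic diagram without classical crossings gives the unit ideal, so `Δ` would be a unit and
  -- hence trivial modulo `p`.
  have h0 : D.1 ≠ [] := by
    intro h0
    rw [h0, firstElementaryIdeal_nil, top_le_iff, Ideal.span_singleton_eq_top] at h₁
    have := Fact.mk hp
    exact hnontrivial (dotEq_iff_associated.2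
      (associated_one_iff_isUnit.2 (h₁.map (reduceMod p))))
  obtain ⟨a, f, hsym, hq⟩ := hP.exists_isCodeSymmetry hPD D.2 h0
  obtain ⟨σ, hJ, hσ⟩ := hsym.exists_perm D.2 h0 hq
  rw [firstElementaryIdeal_eq_adjIdeal h0] at h₁ h₂
  have : Nonempty (crossings D.1) := ⟨⟨_, nextUnder_mem D.2 h0 0⟩⟩
  exact conclusion_of_symmetric (jacobian_row_sum D.2) hJ hp hp' hσ h₁ h₂ hnontrivial

end VirtualKnots

theorem mainTheorem12 (K : VirtualKnots.VirtualKnot) (hK : K.IsAlmostClassical)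
    (Δ : ℤ[T;T⁻¹]) (hΔ : K.IsAlexanderPolynomial Δ)
    (p : ℕ) (hp : p.Prime) (hp_odd : Odd p)
    (hnontrivial : ¬ VirtualKnots.DotEq (VirtualKnots.reduceMod p Δ) 1) :
    ((Irreducible Δ ∧ ∃ g : (ZMod 2)[T;T⁻¹], Irreducible g ∧
        VirtualKnots.DotEq (VirtualKnots.reduceMod 2 Δ) (g ^ 2)) →
      ¬ K.HasPeriod (2 * p)) ∧
    ((∃ g : ℤ[T;T⁻¹], Irreducible g ∧ Irreducible (VirtualKnots.reduceMod 2 g) ∧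
        VirtualKnots.DotEq Δ (g ^ 2)) →
      ¬ K.HasPeriod (2 * p)) := by
  have hp' : p ≠ 2 := by
    rintro rfl
    exact absurd hp_odd (by decide)
  exact ⟨fun h hper => (hper.not_congruences hp hp' hΔ hnontrivial).1 h,
    fun h hper => (hper.not_congruences hp hp' hΔ hnontrivial).2 h⟩
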